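/- Let $d\ge 1$, let $(A,\mathfrak m)$ be an Artinian local ring with infinite residue field $A/\mathfrak m$, let $S=\bigoplus_{\mathbf n\in\mathbb N^d}S_{\mathbf n}$ be a finitely generated standard $\mathbb N^d$-graded (commutative) $A$-algebra (i.e. a finitely generated $A$-algebra generated over $A$ by elements of total degree $1$), let $M=\bigoplus_{\mathbf n\in\mathbb N^d}M_{\mathbf n}$ be a finitely generated $\mathbb N^d$-graded $S$-module, and let $\mathbf k=(k_1,\dots,k_d)\in\mathbb N^d$. Order $\mathbb N^d$ componentwise; $\mathbf h>\mathbf k$ means $\mathbf h\ge\mathbf k$ and $\mathbf h\ne\mathbf k$, and "for all large $\mathbf n$" means for all $\mathbf n\ge\mathbf n_0$ for some $\mathbf n_0\in\mathbb N^d$. Let $\mathbf e_i$ be the $i$-th standard basis vector, $S_i=S_{\mathbf e_i}$ and $S_{++}=\bigoplus_{\mathbf n\ge(1,\dots,1)}S_{\mathbf n}$. Definitions. - For a finitely generated graded $S$-module $N$, $\mathrm{Supp}_{++}N$ is the set of homogeneous prime ideals $P$ of $S$ with $P\not\supseteq S_{++}$ and $N_P\ne0$; its dimension is the supremum of the lengths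 of chains of primes in it, and is $-\infty$ if it is empty. - A sequence $\mathbf x=x_1,\dots,x_t$ in $\bigcup_{j=1}^d S_j$ is of the type $\mathbf k$ if it consists of $k_1$ elements of $S_1$, …, $k_d$ elements of $S_d$ (in any order). It is $S_{++}$-filter-regular with respect to $M$ if for every $1\le i\le t$ one has $(0_{N}:x_i)_{\mathbf n}=0$ for all large $\mathbf n$, where $N=M/(x_1,\dots,x_{i-1})M$. A sequence $\mathbf x$ of the type $\mathbf k$ is a mixed multiplicity system of $M$ of the type $\mathbf k$ if $\dim\mathrm{Supp}_{++}(M/\mathbf xM)\le0$. - The Hilbert polynomial $P_M\in\mathbb Q[n_1,\dots,n_d]$ is the polynomial with $P_M(\mathbf n)=\ell_A(M_{\mathbf n})<\infty$ for all large $\mathbf n$, and the integers $e(M;\mathbf h)$ are defined by $P_M(\mathbf n)=\sum_{\mathbf h\in\mathbb N^d}e(M;\mathbf h)\binom{\mathbf n+\mathbf h}{\mathbf h}$ (a finite sum), where $\binom{\mathbf n+\mathbf h}{\mathbf h}=\prod_{i=1}^d\binom{n_i+h_i}{h_i}$. The mixed multiplicity of $M$ of the type $\mathbf k$ is said to be defined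 if $e(M;\mathbf h)=0$ for all $\mathbf h>\mathbf k$. - $\Delta^{\mathbf k}$ is the $\mathbf k$-difference, the composite over $i$ of the $k_i$-fold iterates of $\Delta^{\mathbf e_i}f(\mathbf n)=f(\mathbf n)-f(\mathbf n-\mathbf e_i)$. Then the polynomial $P_M$ exists and is unique, the integers $e(M;\mathbf h)$ exist and are unique, and the following are equivalent: (i) there exists an $S_{++}$-filter-regular sequence $\mathbf x$ with respect to $M$, of the type $\mathbf k$, which is a mixed multiplicity system of $M$; (ii) there exists a mixed multiplicity system of $M$ of the type $\mathbf k$; (iii) $\Delta^{\mathbf k}P_M(\mathbf n)$ is a constant; (iv) the mixed multiplicity of $M$ of the type $\mathbf k$ is defined. -/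

import Mathlib

namespace MixedMult

open Filter MvPolynomial

section Graded

variable {d : ℕ} {A S M : Type*} [CommRing A] [CommRing S] [Algebra A S]
  [AddCommGroup M] [Module A M] [Module S M] [IsScalarTower A S M]

/-- The `i`-th standard basis vector `e_i` of `ℕ^d`. -/
def e (i : Fin d) : Fin d → ℕ := Pi.single i 1

/-- `S` is a finitely generated standard `ℕ^d`-graded `A`-algebra: it is of finite type over `A`
and generated over `A` by its homogeneous elements of total degree one. -/
structure IsStandardGraded (𝒮 : (Fin d → ℕ) → Submodule A S) : Prop where
  finiteType : Algebra.FiniteType A S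
  generated : Algebra.adjoin A (⋃ i : Fin d, (𝒮 (e i) : Set S)) = ⊤

/-- The ideal `S_{++} = ⨁_{n ≥ (1,…,1)} S_n` of `S`. -/
def plusPlus (𝒮 : (Fin d → ℕ) → Submodule A S) : Ideal S :=
  Ideal.span (⋃ n ∈ Set.Ici (1 : Fin d → ℕ), (𝒮 n : Set S))

/-- `Proj S`: the homogeneous prime ideals of `S` which do not contain `S_{++}`. -/
def multiProj (𝒮 : (Fin d → ℕ) → Submodule A S) [GradedAlgebra 𝒮] : Set (PrimeSpectrum S) :=
  {P | P.asIdeal.IsHomogeneous 𝒮 ∧ ¬ plusPlus 𝒮 ≤ P.asIdeal}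

/-- `Supp_{++} M = {P ∈ Proj S | M_P ≠ 0}`. -/
def suppPlusPlus (𝒮 : (Fin d → ℕ) → Submodule A S) [GradedAlgebra 𝒮]
    (M : Type*) [AddCommGroup M] [Module S M] : Set (PrimeSpectrum S) :=
  {P | P ∈ multiProj 𝒮 ∧ P ∈ Module.support S M}

/-- `dim Supp_{++} M`: the supremum of the lengths of chains of primes in `Supp_{++} M`. It is `⊥`
(that is, `-∞`) if `Supp_{++} M` is empty. -/
noncomputable def dimSuppPlusPlus (𝒮 : (Fin d → ℕ) → Submodule A S) [GradedAlgebra 𝒮]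
    (M : Type*) [AddCommGroup M] [Module S M] : WithBot ℕ∞ :=
  Order.krullDim (suppPlusPlus 𝒮 M)

/-- The submodule `(x_1,…,x_t)M` of `M`. -/
def listSmul (M : Type*) [AddCommGroup M] [Module S M] (x : List S) : Submodule S M :=
  Ideal.ofList x • ⊤

/-- The grading of `M / N`: its component of degree `n` is the image of `M_n`. -/
def quotGrading (ℳ : (Fin d → ℕ) → Submodule A M) (N : Submodule S M) :
    (Fin d → ℕ) → Submodule A (M ⧸ N) :=
  fun n => (ℳ n).map (N.mkQ.restrictScalars A)

/-- `a` is an `S_{++}`-filter-regular element with respect to `M`: `(0_M : a)_n = 0` for all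
large `n`. -/
def IsFilterRegularElement (ℳ : (Fin d → ℕ) → Submodule A M) (a : S) : Prop :=
  ∀ᶠ n in atTop, ∀ m ∈ ℳ n, a • m = 0 → m = 0

/-- `x_1,…,x_t` is an `S_{++}`-filter-regular sequence with respect to `M`: each `x_i` is an
`S_{++}`-filter-regular element with respect to `M / (x_1,…,x_{i-1})M`. -/
def IsFilterRegularSequence (ℳ : (Fin d → ℕ) → Submodule A M) (x : List S) : Prop :=
  ∀ (i : ℕ) (hi : i < x.length),
    IsFilterRegularElement (quotGrading ℳ (listSmul M (x.take i))) x[i]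

/-- The sequence `x` (in any order) consists of `k_1` elements of `S_{e_1}`, …, `k_d` elements of
`S_{e_d}`. The list `j` records the component to which each entry is assigned (the element `0` lies
in all of them). -/
def IsOfType (𝒮 : (Fin d → ℕ) → Submodule A S) (k : Fin d → ℕ) (x : List S) : Prop :=
  ∃ j : List (Fin d), List.Forall₂ (fun a i => a ∈ 𝒮 (e i)) x j ∧ ∀ i, j.count i = k i

/-- `x` is a mixed multiplicity system of `M` of the type `k`. -/
def IsMixedMultiplicitySystem (𝒮 : (Fin d → ℕ) → Submodule A S) [GradedAlgebra 𝒮]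
    (M : Type*) [AddCommGroup M] [Module S M] (k : Fin d → ℕ) (x : List S) : Prop :=
  IsOfType 𝒮 k x ∧ dimSuppPlusPlus 𝒮 (M ⧸ listSmul M x) ≤ 0

/-- `P` is the Hilbert polynomial of `M`: for all large `n`, the `A`-module `M_n` has finite length
equal to `P(n)`. -/
def IsHilbertPolynomial (ℳ : (Fin d → ℕ) → Submodule A M) (P : MvPolynomial (Fin d) ℚ) : Prop :=
  ∀ᶠ n in atTop, ∃ l : ℕ, Module.length A (ℳ n) = l ∧ eval (fun i => (n i : ℚ)) P = l

open Classical in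
/-- The Hilbert polynomial `P_M` (with value `0` if there were none). -/
noncomputable def hilbertPolynomial (ℳ : (Fin d → ℕ) → Submodule A M) :
    MvPolynomial (Fin d) ℚ :=
  if h : ∃ P, IsHilbertPolynomial ℳ P then h.choose else 0

end Graded

section Polynomials

variable {d : ℕ}

/-- The polynomial `binom (n + k) k = ∏ i, binom (n_i + k_i) k_i` in the variables `n_i`, where
`binom (n_i + k_i) k_i = (n_i + 1) ⋯ (n_i + k_i) / k_i !`. -/
noncomputable def binomPoly (k : Fin d → ℕ) : MvPolynomial (Fin d) ℚ :=
  ∏ i, (C ((k i).factorial : ℚ)⁻¹ * ∏ j ∈ Finset.range (k i), (X i + C ((j : ℚ) + 1)))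

/-- The integers `c k` are the coefficients of `P` in the polynomials `binom (n + k) k`. -/
def IsBinomExpansion (P : MvPolynomial (Fin d) ℚ) (c : (Fin d → ℕ) →₀ ℤ) : Prop :=
  P = c.sum fun k z => C (z : ℚ) * binomPoly k

open Classical in
/-- The integer coefficients of `P` in the polynomials `binom (n + k) k` (all `0` if `P` had no such
expansion). -/
noncomputable def binomCoeffs (P : MvPolynomial (Fin d) ℚ) : (Fin d → ℕ) →₀ ℤ :=
  if h : ∃ c, IsBinomExpansion P c then h.choose else 0

/-- The difference operator `P(n) ↦ P(n) - P(n - e_i)`. -/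
noncomputable def diff (i : Fin d) : Module.End ℚ (MvPolynomial (Fin d) ℚ) :=
  LinearMap.id - (aeval fun j => X j - C ((e i j : ℕ) : ℚ)).toLinearMap

/-- The `k`-difference `Δ^k`: the operator `diff i` is applied `k i` times for each `i`. -/
noncomputable def multiDiff (k : Fin d → ℕ) : Module.End ℚ (MvPolynomial (Fin d) ℚ) :=
  ((List.finRange d).map fun i => diff i ^ k i).prod

end Polynomials

section Multiplicity

variable {d : ℕ} {A M : Type*} [CommRing A] [AddCommGroup M] [Module A M]

/-- The integers `e(M; k)` with `P_M(n) = ∑ k, e(M; k) * binom (n + k) k`. -/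
noncomputable def hilbertCoeff (ℳ : (Fin d → ℕ) → Submodule A M) : (Fin d → ℕ) →₀ ℤ :=
  binomCoeffs (hilbertPolynomial ℳ)

/-- The mixed multiplicity of `M` of the type `k` is defined: `e(M; h) = 0` for all `h > k`, where
`h > k` means that `h ≥ k` componentwise and `h ≠ k`. -/
def MixedMultiplicityDefined (ℳ : (Fin d → ℕ) → Submodule A M) (k : Fin d → ℕ) : Prop :=
  ∀ h : Fin d → ℕ, k < h → hilbertCoeff ℳ h = 0

end Multiplicity

end MixedMult

/-! The polynomials `binomPoly h` form a basis of the polynomial ring on which `Δ^k` lowers the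
index by `k`, or gives zero when `k ≤ h` fails. Hence `Δ^h P` reads off the coefficient at any
maximal `h` of the support of `P`. This gives integrality and uniqueness of the coefficients, and
(iii) ⇔ (iv) in `multiDiff_eq_C_iff`.

The rest relies on two facts. A generic `x ∈ S_i` avoids every associated prime of `M` that does not
contain `S_{++}`, and is therefore filter-regular; then `M/xM` has Hilbert polynomial `Δ^{e_i} P_M`
(`isHilbertPolynomial_diff`). Also, `dim Supp_{++} M ≤ 0` exactly when `P_M` is constant
(`dimSuppPlusPlus_le_zero_of_isHilbertPolynomial_C`, `eq_C_of_dimSuppPlusPlus_le_zero`). A generic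
sequence of type `k` thus has a quotient with Hilbert polynomial `Δ^k P_M`, which gives (iii) ⇒ (i).

In (ii) ⇒ (iii) the system need not be filter-regular, and `K = (0 : x)` contributes a correction:
`P_{M/xM}(n) = Δ^{e_i} P_M(n) + P_K(n - e_i)`. All differences of Hilbert polynomials are
nonnegative at large points, being Hilbert polynomials of generic quotients. So if a difference of
the left side vanishes, both terms on the right vanish, and constancy passes from `M/xM` back to `M`
(`multiDiff_add_e_eq_C_of_quotient`). -/

namespace MixedMult

open Filter MvPolynomial

/-! ### Differences, binomial expansions and numerical polynomials. -/

section Polynomials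

variable {d : ℕ}

/-- Evaluation of a polynomial at a point of `ℕ^d`. -/
noncomputable abbrev evalNat (n : Fin d → ℕ) : MvPolynomial (Fin d) ℚ →+* ℚ :=
  eval fun i => (n i : ℚ)

/-- A polynomial is determined by its values on a product of infinite sets. Most polynomial
identities below are checked at large points in this way. -/
theorem eq_of_eventually_evalNat_eq {P Q : MvPolynomial (Fin d) ℚ}
    (h : ∀ᶠ n in atTop, evalNat n P = evalNat n Q) : P = Q := by
  obtain ⟨n₀, hn₀⟩ := eventually_atTop.1 h
  refine MvPolynomial.funext_set (fun i => (fun m : ℕ => (m : ℚ)) '' Set.Ici (n₀ i))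
    (fun i => (Set.Ici_infinite (n₀ i)).image (Nat.cast_injective.injOn)) fun x hx => ?_
  choose n hn hx using fun i => hx i (Set.mem_univ i)
  obtain rfl : (fun i => (n i : ℚ)) = x := funext hx
  exact hn₀ n hn

theorem eventually_add {p : (Fin d → ℕ) → Prop} (h : ∀ᶠ n in atTop, p n) (b : Fin d → ℕ) :
    ∀ᶠ n in atTop, p (n + b) := by
  obtain ⟨n₀, hn₀⟩ := eventually_atTop.1 h
  exact eventually_atTop.2 ⟨n₀, fun n hn => hn₀ _ (hn.trans le_self_add)⟩

theorem eventually_of_add {p : (Fin d → ℕ) → Prop} {b : Fin d → ℕ}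
    (h : ∀ᶠ n in atTop, p (n + b)) : ∀ᶠ n in atTop, p n := by
  obtain ⟨n₀, hn₀⟩ := eventually_atTop.1 h
  refine eventually_atTop.2 ⟨n₀ + b, fun n hn => ?_⟩
  have hb : b ≤ n := le_trans le_add_self hn
  have := hn₀ (n - b) (le_tsub_of_add_le_right hn)
  rwa [tsub_add_cancel_of_le hb] at this

/-- Evaluating at `n + e i` avoids truncated subtraction in `ℕ^d`. -/
theorem evalNat_diff (i : Fin d) (P : MvPolynomial (Fin d) ℚ) (n : Fin d → ℕ) :
    evalNat (n + e i) (diff i P) = evalNat (n + e i) P - evalNat n P := by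
  have : evalNat (n + e i) ((aeval fun j => X j - C ((e i j : ℕ) : ℚ)) P) = evalNat n P := by
    simp only [evalNat, aeval_eq_bind₁]
    induction P using MvPolynomial.induction_on with
    | C a => simp
    | add p q hp hq => simp only [map_add, hp, hq]
    | mul_X p j hp => simp only [map_mul, hp]; simp
  simp only [diff, LinearMap.sub_apply, LinearMap.id_apply, AlgHom.toLinearMap_apply, map_sub, this]

theorem evalNat_binomPoly (h n : Fin d → ℕ) :
    evalNat n (binomPoly h) = ∏ i, ((n i + h i).choose (h i) : ℚ) := by
  simp only [evalNat, binomPoly, map_prod, map_mul, eval_C, map_add, eval_X]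
  refine Finset.prod_congr rfl fun i _ => ?_
  rw [inv_mul_eq_iff_eq_mul₀ (by positivity)]
  induction h i with
  | zero => simp
  | succ m ih =>
    have h1 : ((n i + m + 1 : ℕ) : ℚ) * ((n i + m).choose m : ℕ) =
        ((n i + m + 1).choose (m + 1) : ℕ) * ((m + 1 : ℕ) : ℚ) := by
      exact_mod_cast Nat.add_one_mul_choose_eq (n i + m) m
    rw [Finset.prod_range_succ, ih, ← add_assoc, Nat.factorial_succ]
    push_cast at h1 ⊢
    linear_combination (m.factorial : ℚ) * h1

theorem binomPoly_zero : binomPoly (0 : Fin d → ℕ) = 1 := by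
  simp [binomPoly]

@[simp] theorem e_same (i : Fin d) : e i i = 1 := by simp [e]

theorem e_of_ne {i j : Fin d} (h : j ≠ i) : e i j = 0 := by simp [e, h]

theorem diff_binomPoly_of_eq_zero {i : Fin d} {h : Fin d → ℕ} (hi : h i = 0) :
    diff i (binomPoly h) = 0 := by
  refine eq_of_eventually_evalNat_eq (eventually_of_add (b := e i) (.of_forall fun n => ?_))
  rw [evalNat_diff, evalNat_binomPoly, evalNat_binomPoly, map_zero, sub_eq_zero]
  refine Finset.prod_congr rfl fun j _ => ?_
  rcases eq_or_ne j i with rfl | hj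
  · simp [hi]
  · simp [e_of_ne hj]

theorem diff_binomPoly_add (i : Fin d) (h : Fin d → ℕ) :
    diff i (binomPoly (h + e i)) = binomPoly h := by
  refine eq_of_eventually_evalNat_eq (eventually_of_add (b := e i) (.of_forall fun n => ?_))
  rw [evalNat_diff, evalNat_binomPoly, evalNat_binomPoly, evalNat_binomPoly,
    ← Finset.mul_prod_erase _ _ (Finset.mem_univ i), ← Finset.mul_prod_erase _ _ (Finset.mem_univ i),
    ← Finset.mul_prod_erase _ _ (Finset.mem_univ i)]
  have h1 : ∀ j ∈ Finset.univ.erase i, (((n + e i) j + (h + e i) j).choose ((h + e i) j) : ℚ) =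
      ((n + e i) j + h j).choose (h j) := fun j hj => by
    simp [e_of_ne (Finset.ne_of_mem_erase hj)]
  have h2 : ∀ j ∈ Finset.univ.erase i, ((n j + (h + e i) j).choose ((h + e i) j) : ℚ) =
      ((n + e i) j + h j).choose (h j) := fun j hj => by
    simp [e_of_ne (Finset.ne_of_mem_erase hj)]
  rw [Finset.prod_congr rfl h1, Finset.prod_congr rfl h2, ← sub_mul]
  congr 1
  simp only [Pi.add_apply, e_same]
  have : n i + 1 + (h i + 1) = (n i + (h i + 1)) + 1 := by ring
  rw [this, Nat.choose_succ_succ, show n i + 1 + h i = n i + (h i + 1) by ring]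
  push_cast
  ring

theorem diff_C (i : Fin d) (c : ℚ) : diff i (C c) = 0 := by
  simp [diff]

/-- The span contains `1` and is closed under multiplication by each variable, since `B_h X_i = (h_i
+ 1)(B_{h+e_i} - B_h)`. -/
theorem span_binomPoly : Submodule.span ℚ (Set.range (binomPoly (d := d))) = ⊤ := by
  rw [eq_top_iff]
  rintro P -
  induction P using MvPolynomial.induction_on with
  | C a =>
    rw [← mul_one (C a), ← binomPoly_zero, ← smul_eq_C_mul]
    exact Submodule.smul_mem _ _ (Submodule.subset_span ⟨0, rfl⟩)
  | add p q hp hq => exact add_mem hp hq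
  | mul_X p i hp =>
    induction hp using Submodule.span_induction with
    | zero => simp
    | add p q _ _ hp hq => rw [add_mul]; exact add_mem hp hq
    | smul a p _ hp => rw [smul_mul_assoc]; exact Submodule.smul_mem _ _ hp
    | mem p hp =>
      obtain ⟨h, rfl⟩ := hp
      have : binomPoly h * X i = ((h i : ℚ) + 1) • binomPoly (h + e i) -
          ((h i : ℚ) + 1) • binomPoly h := by
        refine eq_of_eventually_evalNat_eq (.of_forall fun n => ?_)
        simp only [smul_eq_C_mul, map_sub, map_mul, evalNat_binomPoly, eval_C, eval_X]
        rw [← Finset.mul_prod_erase _ _ (Finset.mem_univ i),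
          ← Finset.mul_prod_erase _ (fun j => (((n j + (h + e i) j).choose ((h + e i) j) : ℕ) : ℚ))
            (Finset.mem_univ i)]
        have h2 : ∀ j ∈ Finset.univ.erase i, ((n j + (h + e i) j).choose ((h + e i) j) : ℚ) =
            (n j + h j).choose (h j) := fun j hj => by
          simp [e_of_ne (Finset.ne_of_mem_erase hj)]
        rw [Finset.prod_congr rfl h2, ← mul_assoc, ← mul_assoc, ← sub_mul, mul_right_comm]
        congr 1
        simp only [Pi.add_apply, e_same]
        have := Nat.add_one_mul_choose_eq (n i + h i) (h i)
        rw [← add_assoc]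
        have h3 : ((n i + h i + 1).choose (h i + 1) : ℚ) * (h i + 1) =
            (n i + h i + 1) * (n i + h i).choose (h i) := by exact_mod_cast this.symm
        linear_combination -h3
      rw [this]
      exact sub_mem (Submodule.smul_mem _ _ (Submodule.subset_span ⟨_, rfl⟩))
        (Submodule.smul_mem _ _ (Submodule.subset_span ⟨_, rfl⟩))

/-- Every polynomial is a rational combination of the `binomPoly h`. -/
theorem exists_eq_sum_binomPoly (P : MvPolynomial (Fin d) ℚ) :
    ∃ c : (Fin d → ℕ) →₀ ℚ, P = c.sum fun h z => C z * binomPoly h := by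
  have : P ∈ Submodule.span ℚ (Set.range (binomPoly (d := d))) := by simp [span_binomPoly]
  obtain ⟨c, hc⟩ := (Finsupp.mem_span_range_iff_exists_finsupp).1 this
  exact ⟨c, by simp [← hc, smul_eq_C_mul]⟩

theorem exists_diff_eq (i : Fin d) (G : MvPolynomial (Fin d) ℚ) : ∃ H, diff i H = G := by
  have : G ∈ Submodule.span ℚ (Set.range (binomPoly (d := d))) := by simp [span_binomPoly]
  rw [← LinearMap.mem_range]
  refine Submodule.span_le.2 ?_ this
  rintro _ ⟨h, rfl⟩
  exact ⟨_, diff_binomPoly_add i h⟩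

theorem linearMap_ext_binomPoly {f g : Module.End ℚ (MvPolynomial (Fin d) ℚ)}
    (h : ∀ k, f (binomPoly k) = g (binomPoly k)) : f = g :=
  LinearMap.ext_on span_binomPoly (by rintro _ ⟨k, rfl⟩; exact h k)

theorem exists_eq_add_e {i : Fin d} {h : Fin d → ℕ} (hi : h i ≠ 0) : ∃ h', h = h' + e i := by
  refine ⟨h - e i, funext fun j => ?_⟩
  rcases eq_or_ne j i with rfl | hj
  · simp only [Pi.add_apply, Pi.sub_apply, e_same]; omega
  · simp [e_of_ne hj]

theorem diff_commute (i j : Fin d) : Commute (diff i) (diff j) := by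
  refine linearMap_ext_binomPoly fun h => ?_
  simp only [Module.End.mul_apply]
  rcases eq_or_ne i j with rfl | hij
  · rfl
  by_cases hi : h i = 0
  · rw [diff_binomPoly_of_eq_zero hi, map_zero]
    by_cases hj : h j = 0
    · rw [diff_binomPoly_of_eq_zero hj, map_zero]
    · obtain ⟨h, rfl⟩ := exists_eq_add_e hj
      rw [diff_binomPoly_add, diff_binomPoly_of_eq_zero]
      simpa [e_of_ne hij] using hi
  · obtain ⟨h, rfl⟩ := exists_eq_add_e hi
    rw [diff_binomPoly_add]
    by_cases hj : h j = 0
    · rw [diff_binomPoly_of_eq_zero hj, diff_binomPoly_of_eq_zero (by simp [hj, e_of_ne hij.symm]),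
        map_zero]
    · obtain ⟨h, rfl⟩ := exists_eq_add_e hj
      rw [diff_binomPoly_add, add_right_comm, diff_binomPoly_add, diff_binomPoly_add]

theorem multiDiff_zero : multiDiff (0 : Fin d → ℕ) = 1 := by
  simp [multiDiff]

theorem multiDiff_add_e (k : Fin d → ℕ) (j : Fin d) :
    multiDiff (k + e j) = multiDiff k * diff j := by
  have key : ∀ l : List (Fin d), (l.map fun i => diff i ^ (k + e j) i).prod =
      (l.map fun i => diff i ^ k i).prod * diff j ^ l.count j := fun l => by
    induction l with
    | nil => simp
    | cons i l ih =>
      have hc : Commute (diff j) (l.map fun i => diff i ^ k i).prod := by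
        refine Commute.list_prod_right _ _ fun x hx => ?_
        obtain ⟨a, -, rfl⟩ := List.mem_map.1 hx
        exact (diff_commute j a).pow_right _
      rw [List.map_cons, List.prod_cons, ih, List.map_cons, List.prod_cons]
      rcases eq_or_ne i j with rfl | hij
      · rw [List.count_cons_self, Pi.add_apply, e_same, pow_succ, pow_succ', mul_assoc, mul_assoc,
          ← mul_assoc (diff i), hc.eq, mul_assoc]
      · rw [List.count_cons_of_ne hij, Pi.add_apply, e_of_ne hij, add_zero, mul_assoc]
  rw [multiDiff, key, List.count_finRange, pow_one, multiDiff]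

theorem induction_add_e {p : (Fin d → ℕ) → Prop} (zero : p 0) (add : ∀ h i, p h → p (h + e i))
    (h : Fin d → ℕ) : p h := by
  induction hs : ∑ i, h i using Nat.strong_induction_on generalizing h with
  | _ m ih =>
    by_cases h0 : h = 0
    · rwa [h0]
    · obtain ⟨i, hi⟩ := Function.ne_iff.1 h0
      obtain ⟨h, rfl⟩ := exists_eq_add_e hi
      refine add h i (ih _ ?_ h rfl)
      rw [← hs]
      simp only [Pi.add_apply, Finset.sum_add_distrib]
      have : e i i ≤ ∑ j, e i j := Finset.single_le_sum (fun _ _ => Nat.zero_le _) (Finset.mem_univ i)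
      rw [e_same] at this
      omega

theorem multiDiff_add (h k : Fin d → ℕ) : multiDiff (h + k) = multiDiff h * multiDiff k := by
  induction k using induction_add_e with
  | zero => simp [multiDiff_zero]
  | add k i ih => rw [← add_assoc, multiDiff_add_e, ih, multiDiff_add_e, mul_assoc]

theorem multiDiff_binomPoly_add (h k : Fin d → ℕ) : multiDiff k (binomPoly (h + k)) = binomPoly h := by
  induction k using induction_add_e with
  | zero => simp [multiDiff_zero]
  | add k i ih => rw [← add_assoc, multiDiff_add_e, Module.End.mul_apply, diff_binomPoly_add, ih]

theorem multiDiff_C {k : Fin d → ℕ} (hk : k ≠ 0) (c : ℚ) : multiDiff k (C c) = 0 := by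
  obtain ⟨i, hi⟩ := Function.ne_iff.1 hk
  obtain ⟨h, rfl⟩ := exists_eq_add_e hi
  rw [multiDiff_add_e, Module.End.mul_apply, diff_C, map_zero]

theorem multiDiff_binomPoly_of_not_le {h k : Fin d → ℕ} (hk : ¬ k ≤ h) :
    multiDiff k (binomPoly h) = 0 := by
  obtain ⟨i, hi⟩ : ∃ i, h i < k i := by simpa [Pi.le_def] using hk
  -- Each `diff i` lowers the `i`-th index by one and kills the polynomial once it reaches zero; `l`
  -- absorbs all remaining differences.
  have : ∀ (m : ℕ) (h : Fin d → ℕ), h i < m → ∀ l, multiDiff (l + m • e i) (binomPoly h) = 0 := by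
    intro m
    induction m with
    | zero => intro h hm; omega
    | succ m ih =>
      intro h hm l
      rw [succ_nsmul, ← add_assoc, multiDiff_add_e, Module.End.mul_apply]
      by_cases h0 : h i = 0
      · rw [diff_binomPoly_of_eq_zero h0, map_zero]
      · obtain ⟨h, rfl⟩ := exists_eq_add_e h0
        rw [diff_binomPoly_add]
        refine ih h ?_ l
        simp only [Pi.add_apply, e_same] at hm
        omega
  have hk : k = (k - k i • e i) + k i • e i := funext fun j => by
    rcases eq_or_ne j i with rfl | hj
    · simp
    · simp [e_of_ne hj]
  rw [hk]
  exact this _ _ hi _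

/-- If `P = ∑ c_h B_h` and `c_h = 0` for all `h > k`, then `Δ^k P = c_k`. -/
theorem multiDiff_sum {R : Type*} [Zero R] (φ : R → ℚ) (hφ : φ 0 = 0)
    (c : (Fin d → ℕ) →₀ R) {k : Fin d → ℕ} (hc : ∀ h, k < h → c h = 0) :
    multiDiff k (c.sum fun h z => C (φ z) * binomPoly h) = C (φ (c k)) := by
  rw [Finsupp.sum, map_sum, Finset.sum_eq_single k]
  · have := multiDiff_binomPoly_add 0 k
    rw [zero_add, binomPoly_zero] at this
    rw [← smul_eq_C_mul, map_smul, this, smul_eq_C_mul, mul_one]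
  · intro h hh hk
    rw [← smul_eq_C_mul, map_smul, multiDiff_binomPoly_of_not_le, smul_zero]
    exact fun hkh => (Finsupp.mem_support_iff.1 hh) (hc h (lt_of_le_of_ne hkh hk.symm))
  · intro hk
    rw [Finsupp.notMem_support_iff.1 hk, hφ, C_0, zero_mul, map_zero]

theorem exists_maximal_of_ne_zero {R : Type*} [Zero R] {c : (Fin d → ℕ) →₀ R} {p : (Fin d → ℕ) → Prop}
    (hp : ∀ h, p h → c h ≠ 0) {k : Fin d → ℕ} (hk : p k) : ∃ h, k ≤ h ∧ p h ∧ ∀ h', h < h' → ¬ p h' := by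
  have hfin : {h | p h}.Finite := c.support.finite_toSet.subset fun h hh => by
    simpa using hp h hh
  obtain ⟨h, hkh, hh⟩ := hfin.exists_le_maximal hk
  exact ⟨h, hkh, hh.prop, fun h' hlt hp' => hlt.not_ge (hh.le_of_ge hp' hlt.le)⟩

/-- If the difference of two expansions were nonzero, `Δ^h` at a maximal `h` of its support would
extract a nonzero coefficient from the zero polynomial. -/
theorem isBinomExpansion_unique {P : MvPolynomial (Fin d) ℚ} {c c' : (Fin d → ℕ) →₀ ℤ}
    (hc : IsBinomExpansion P c) (hc' : IsBinomExpansion P c') : c = c' := by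
  rw [← sub_eq_zero]
  have h0 : (c - c').sum (fun h z => C (z : ℚ) * binomPoly h) = 0 := by
    rw [Finsupp.sum_sub_index (fun h a b => by push_cast; rw [map_sub, sub_mul]), sub_eq_zero]
    exact hc.symm.trans hc'
  by_contra hne
  obtain ⟨k, hk⟩ := Finsupp.ne_iff.1 hne
  obtain ⟨h, -, hh, hmax⟩ := exists_maximal_of_ne_zero (p := fun h => (c - c') h ≠ 0)
    (fun _ h => h) hk
  have := multiDiff_sum (fun z : ℤ => (z : ℚ)) Int.cast_zero (c - c') (k := h)
    fun h' hlt => not_not.1 (hmax h' hlt)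
  rw [h0, map_zero, eq_comm, C_eq_zero] at this
  exact hh (by exact_mod_cast this)

/-- Polynomials with integer values at all large points of `ℕ^d`. -/
def EventuallyInteger (P : MvPolynomial (Fin d) ℚ) : Prop :=
  ∀ᶠ n in atTop, ∃ z : ℤ, evalNat n P = z

theorem EventuallyInteger.sub {P Q : MvPolynomial (Fin d) ℚ} (hP : EventuallyInteger P)
    (hQ : EventuallyInteger Q) : EventuallyInteger (P - Q) := by
  filter_upwards [hP, hQ] with n ⟨z, hz⟩ ⟨w, hw⟩
  exact ⟨z - w, by rw [map_sub, hz, hw]; push_cast; rfl⟩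

theorem EventuallyInteger.multiDiff {P : MvPolynomial (Fin d) ℚ} (hP : EventuallyInteger P)
    (k : Fin d → ℕ) : EventuallyInteger (multiDiff k P) := by
  induction k using induction_add_e generalizing P with
  | zero => simpa [multiDiff_zero]
  | add k i ih =>
    rw [multiDiff_add_e]
    refine ih (eventually_of_add (b := e i) ?_)
    filter_upwards [hP, eventually_add hP (e i)] with n ⟨z, hz⟩ ⟨w, hw⟩
    exact ⟨w - z, by rw [evalNat_diff, hz, hw]; push_cast; rfl⟩

theorem eventuallyInteger_int_mul_binomPoly (z : ℤ) (h : Fin d → ℕ) :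
    EventuallyInteger (C (z : ℚ) * binomPoly h) := by
  refine .of_forall fun n => ⟨z * ∏ i, ((n i + h i).choose (h i) : ℤ), ?_⟩
  rw [map_mul, evalNat_binomPoly]
  simp

/-- `Δ^k` preserves integrality of values and, at a maximal index `k`, yields the coefficient
itself. Removing that term leaves an integer-valued polynomial with smaller support. -/
theorem exists_isBinomExpansion {P : MvPolynomial (Fin d) ℚ} (hP : EventuallyInteger P) :
    ∃ c, IsBinomExpansion P c := by
  obtain ⟨c, rfl⟩ := exists_eq_sum_binomPoly P
  suffices hc : ∀ h, ∃ z : ℤ, c h = z by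
    choose z hz using hc
    have hz' : ∀ h, z h ≠ 0 ↔ c h ≠ 0 := fun h => by rw [hz h]; simp
    refine ⟨Finsupp.onFinset c.support z fun h hh => by simpa using (hz' h).1 hh, ?_⟩
    rw [IsBinomExpansion, Finsupp.onFinset_sum _ fun h => by simp, Finsupp.sum]
    exact Finset.sum_congr rfl fun h _ => by rw [hz]
  induction hn : c.support.card using Nat.strong_induction_on generalizing c with
  | _ m ih =>
    intro h
    by_cases hh : c h = 0
    · exact ⟨0, by simp [hh]⟩
    obtain ⟨k, -, hk, hmax⟩ := exists_maximal_of_ne_zero (p := fun h => c h ≠ 0) (fun _ h => h) hh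
    have hint : ∃ z : ℤ, c k = z := by
      have h1 := hP.multiDiff k
      rw [multiDiff_sum (fun z : ℚ => z) rfl c fun h' hlt => not_not.1 (hmax h' hlt)] at h1
      obtain ⟨n, z, hz⟩ := h1.exists
      exact ⟨z, by simpa using hz⟩
    rcases eq_or_ne h k with rfl | hne
    · exact hint
    obtain ⟨z, hz⟩ := hint
    have hsum : (c.erase k).sum (fun h z => C z * binomPoly h) =
        c.sum (fun h z => C z * binomPoly h) - C (z : ℚ) * binomPoly k := by
      rw [← hz, eq_sub_iff_add_eq, add_comm]
      exact Finsupp.add_sum_erase c k (fun h z => C z * binomPoly h)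
        (Finsupp.mem_support_iff.2 hk)
    have h2 : EventuallyInteger ((c.erase k).sum fun h z => C z * binomPoly h) := by
      rw [hsum]
      exact hP.sub (eventuallyInteger_int_mul_binomPoly z k)
    have := ih _ (by
      rw [← hn, Finsupp.support_erase]
      exact Finset.card_erase_lt_of_mem (Finsupp.mem_support_iff.2 hk)) _ h2 rfl h
    rwa [Finsupp.erase_ne hne] at this

/-- `Δ^k P` is constant if and only if the coefficients of `P` above `k` vanish. -/
theorem multiDiff_eq_C_iff {P : MvPolynomial (Fin d) ℚ} {c : (Fin d → ℕ) →₀ ℤ}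
    (hc : IsBinomExpansion P c) (k : Fin d → ℕ) :
    (∃ a, multiDiff k P = C a) ↔ ∀ h, k < h → c h = 0 := by
  constructor
  · rintro ⟨a, ha⟩ h hkh
    by_contra hne
    -- At a maximal `h' ≥ h`, `Δ^{h'} P` is the nonzero constant `c h'`; but it is also `Δ^{h'-k}`
    -- of a constant with `h' - k ≠ 0`, hence zero.
    obtain ⟨h', hh', hne', hmax⟩ := exists_maximal_of_ne_zero (p := fun h => c h ≠ 0)
      (fun _ h => h) hne
    have h1 := multiDiff_sum (fun z : ℤ => (z : ℚ)) Int.cast_zero c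
      fun l hlt => not_not.1 (hmax l hlt)
    have hlt := hkh.trans_le hh'
    rw [← show P = _ from hc, ← tsub_add_cancel_of_le hlt.le, multiDiff_add, Module.End.mul_apply,
      ha, multiDiff_C, tsub_add_cancel_of_le hlt.le, eq_comm, C_eq_zero] at h1
    · exact hne' (by exact_mod_cast h1)
    · exact fun h0 => hlt.not_ge (tsub_eq_zero_iff_le.1 h0)
  · intro h
    rw [show P = _ from hc]
    exact ⟨_, multiDiff_sum (fun z : ℤ => (z : ℚ)) Int.cast_zero c h⟩

theorem eq_C_of_diff_eq_zero {P : MvPolynomial (Fin d) ℚ} (hP : ∀ i, diff i P = 0) :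
    ∃ a, P = C a := by
  have : ∀ n : Fin d → ℕ, evalNat n P = evalNat 0 P := fun n => by
    induction n using induction_add_e with
    | zero => rfl
    | add n i ih => rw [← ih, ← sub_eq_zero, ← evalNat_diff, hP, map_zero]
  exact ⟨evalNat 0 P, eq_of_eventually_evalNat_eq (.of_forall fun n => by rw [this n, eval_C])⟩

/-- A function whose differences are polynomials at all large points is a polynomial at all large
points. -/
theorem exists_polynomial_of_differences (f : (Fin d → ℕ) → ℚ)
    (hf : ∀ i, ∃ G : MvPolynomial (Fin d) ℚ, ∀ᶠ n in atTop, f (n + e i) - f n = evalNat (n + e i) G) :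
    ∃ P : MvPolynomial (Fin d) ℚ, ∀ᶠ n in atTop, f n = evalNat n P := by
  choose G hG using hf
  choose H hH using fun i => exists_diff_eq i (G i)
  obtain ⟨n₀, hn₀⟩ := eventually_atTop.1 (eventually_all.2 hG)
  have hshift : ∀ n ≥ n₀, ∀ i, f (n + e i) - evalNat (n + e i) (H i) = f n - evalNat n (H i) := by
    intro n hn i
    have := hn₀ n hn i
    rw [← hH i, evalNat_diff] at this
    linear_combination this
  -- `f - H i` does not change along direction `i`, so its `i`-th coordinate may be reset to `n₀ i`.
  have hupd : ∀ n ≥ n₀, ∀ i, f n - evalNat n (H i) = f (Function.update n i (n₀ i)) -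
      evalNat (Function.update n i (n₀ i)) (H i) := by
    intro n hn i
    have key : ∀ m, f (Function.update n i (n₀ i + m)) -
        evalNat (Function.update n i (n₀ i + m)) (H i) = f (Function.update n i (n₀ i)) -
        evalNat (Function.update n i (n₀ i)) (H i) := fun m => by
      induction m with
      | zero => rfl
      | succ m ih =>
        rw [← ih, ← hshift (Function.update n i (n₀ i + m))]
        · have : Function.update n i (n₀ i + (m + 1)) = Function.update n i (n₀ i + m) + e i :=
            funext fun j => by
              rcases eq_or_ne j i with rfl | hj
              · simp; ring
              · simp [e_of_ne hj, hj]
          rw [this]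
        · intro j
          rcases eq_or_ne j i with rfl | hj
          · simp
          · simpa [hj] using hn j
    rw [← key (n i - n₀ i), add_tsub_cancel_of_le (hn i), Function.update_eq_self]
  -- The coordinates outside `s` are frozen at `n₀` and released one at a time; releasing `i`
  -- changes `f` by a difference of two values of `H i`.
  have main : ∀ s : Finset (Fin d), ∃ P : MvPolynomial (Fin d) ℚ, ∀ n ≥ n₀,
      f (fun j => if j ∈ s then n j else n₀ j) = evalNat n P := fun s => by
    induction s using Finset.induction_on with
    | empty => exact ⟨C (f n₀), fun n _ => by simp⟩
    | insert i s hi ih =>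
      obtain ⟨P, hP⟩ := ih
      let sub (s : Finset (Fin d)) : MvPolynomial (Fin d) ℚ →ₐ[ℚ] MvPolynomial (Fin d) ℚ :=
        aeval fun j => if j ∈ s then X j else C (n₀ j : ℚ)
      have hsub : ∀ (s : Finset (Fin d)) (n : Fin d → ℕ) (Q : MvPolynomial (Fin d) ℚ),
          evalNat n (sub s Q) = evalNat (fun j => if j ∈ s then n j else n₀ j) Q := by
        intro s n Q
        induction Q using MvPolynomial.induction_on with
        | C a => simp [sub]
        | add p q hp hq => simp only [map_add, hp, hq]
        | mul_X p j hp =>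
          simp only [map_mul, hp]
          congr 1
          by_cases hj : j ∈ s <;> simp [sub, hj]
      refine ⟨P + sub (insert i s) (H i) - sub s (H i), fun n hn => ?_⟩
      have h1 := hupd (fun j => if j ∈ insert i s then n j else n₀ j)
        (fun j => by by_cases hj : j ∈ insert i s <;> simp only [hj, if_true, if_false]; exacts [hn j, le_rfl]) i
      have h2 : Function.update (fun j => if j ∈ insert i s then n j else n₀ j) i (n₀ i) =
          fun j => if j ∈ s then n j else n₀ j := funext fun j => by
        rcases eq_or_ne j i with rfl | hj
        · simp [hi]
        · simp [hj]
      rw [h2, hP n hn] at h1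
      rw [map_sub, map_add, hsub, hsub]
      linear_combination h1
  obtain ⟨P, hP⟩ := main Finset.univ
  exact ⟨P, eventually_atTop.2 ⟨n₀, fun n hn => by simpa using hP n hn⟩⟩

end Polynomials

end MixedMult

namespace MixedMult

open Filter MvPolynomial

/-! ### Gradings as families of projections, which pass to homogeneous submodules and quotients. -/

section GradedModules

variable {d : ℕ} {A S M : Type*} [CommRing A] [CommRing S] [Algebra A S]
  [AddCommGroup M] [Module A M] [Module S M] [IsScalarTower A S M]

/-- A grading of the `S`-module `M` compatible with `𝒮`, given by its projections. -/
structure HomProj (𝒮 : (Fin d → ℕ) → Submodule A S) (ℳ : (Fin d → ℕ) → Submodule A M) where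
  proj : (Fin d → ℕ) → M →ₗ[A] M
  proj_mem : ∀ n m, proj n m ∈ ℳ n
  proj_of_mem : ∀ {n m}, m ∈ ℳ n → proj n m = m
  proj_of_ne : ∀ {n n' m}, m ∈ ℳ n → n ≠ n' → proj n' m = 0
  exists_sum : ∀ m, ∃ s : Finset (Fin d → ℕ), m = ∑ n ∈ s, proj n m
  smul_mem : ∀ {i j a m}, a ∈ 𝒮 i → m ∈ ℳ j → a • m ∈ ℳ (i + j)

/-- The grading induced on a submodule. -/
def subGrading (ℳ : (Fin d → ℕ) → Submodule A M) (K : Submodule S M) :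
    (Fin d → ℕ) → Submodule A K :=
  fun n => (ℳ n).comap (K.subtype.restrictScalars A)

namespace HomProj

/-- The projections of a graded module. -/
noncomputable def ofDecomposition (𝒮 : (Fin d → ℕ) → Submodule A S)
    (ℳ : (Fin d → ℕ) → Submodule A M) [DirectSum.Decomposition ℳ] [SetLike.GradedSMul 𝒮 ℳ] :
    HomProj 𝒮 ℳ := by
  classical
  exact
  { proj := fun n =>
      { toFun := fun m => (DirectSum.decompose ℳ m n : M)
        map_add' := fun a b => by simp
        map_smul' := fun r a => by
          rw [← DirectSum.decomposeLinearEquiv_apply ℳ, map_smul]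
          rfl }
    proj_mem := fun n m => (DirectSum.decompose ℳ m n).2
    proj_of_mem := fun h => DirectSum.decompose_of_mem_same ℳ h
    proj_of_ne := fun h hne => DirectSum.decompose_of_mem_ne ℳ h hne
    exists_sum := fun m => ⟨_, (DirectSum.sum_support_decompose ℳ m).symm⟩
    smul_mem := fun ha hm => SetLike.GradedSMul.smul_mem ha hm }

variable {𝒮 : (Fin d → ℕ) → Submodule A S} {ℳ : (Fin d → ℕ) → Submodule A M}
variable (hM : HomProj 𝒮 ℳ)
include hM

omit [IsScalarTower A S M] in
theorem induction {p : M → Prop} (zero : p 0) (add : ∀ a b, p a → p b → p (a + b))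
    (hom : ∀ n, ∀ m ∈ ℳ n, p m) (m : M) : p m := by
  obtain ⟨s, hs⟩ := hM.exists_sum m
  rw [hs]
  exact Finset.sum_induction _ p add zero fun n _ => hom n _ (hM.proj_mem n m)

omit [IsScalarTower A S M] in
theorem proj_smul {i : Fin d → ℕ} {a : S} (ha : a ∈ 𝒮 i) (n : Fin d → ℕ) (m : M) :
    hM.proj (i + n) (a • m) = a • hM.proj n m := by
  induction m using hM.induction with
  | zero => simp
  | add x y hx hy => rw [smul_add, map_add, map_add, hx, hy, smul_add]
  | hom j m hm =>
    rcases eq_or_ne j n with rfl | hj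
    · rw [hM.proj_of_mem hm, hM.proj_of_mem (hM.smul_mem ha hm)]
    · rw [hM.proj_of_ne hm hj, smul_zero,
        hM.proj_of_ne (hM.smul_mem ha hm) fun h => hj (add_left_cancel h)]

omit [IsScalarTower A S M] in
theorem proj_smul_of_not_le {i : Fin d → ℕ} {a : S} (ha : a ∈ 𝒮 i) {n : Fin d → ℕ} (hn : ¬ i ≤ n)
    (m : M) : hM.proj n (a • m) = 0 := by
  induction m using hM.induction with
  | zero => simp
  | add x y hx hy => rw [smul_add, map_add, hx, hy, add_zero]
  | hom j m hm =>
    exact hM.proj_of_ne (hM.smul_mem ha hm) fun h => hn (h ▸ le_self_add)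

/-- `N` is stable under the projections, i.e. it is a homogeneous submodule. -/
def IsHomogeneous (N : Submodule S M) : Prop := ∀ n, ∀ m ∈ N, hM.proj n m ∈ N

variable {hM} in
/-- The quotient by a homogeneous submodule. -/
noncomputable def quot {N : Submodule S M} (hN : hM.IsHomogeneous N) :
    HomProj 𝒮 (quotGrading ℳ N) where
  proj := fun n =>
    (Submodule.Quotient.restrictScalarsEquiv A N).toLinearMap ∘ₗ
      ((N.restrictScalars A).mapQ (N.restrictScalars A) (hM.proj n) fun m hm => hN n m hm) ∘ₗ
      (Submodule.Quotient.restrictScalarsEquiv A N).symm.toLinearMap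
  proj_mem := fun n m => by
    obtain ⟨m, rfl⟩ := N.mkQ_surjective m
    exact ⟨hM.proj n m, hM.proj_mem n m, rfl⟩
  proj_of_mem := by
    rintro n _ ⟨m, hm, rfl⟩
    change N.mkQ (hM.proj n m) = N.mkQ m
    rw [hM.proj_of_mem hm]
  proj_of_ne := by
    rintro n n' _ ⟨m, hm, rfl⟩ hne
    change N.mkQ (hM.proj n' m) = 0
    rw [hM.proj_of_ne hm hne, map_zero]
  exists_sum := fun m => by
    obtain ⟨m, rfl⟩ := N.mkQ_surjective m
    obtain ⟨s, hs⟩ := hM.exists_sum m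
    exact ⟨s, (congrArg N.mkQ hs).trans (map_sum N.mkQ _ s)⟩
  smul_mem := by
    rintro i j a _ ha ⟨m, hm, rfl⟩
    exact ⟨a • m, hM.smul_mem ha hm, rfl⟩

variable {hM} in
/-- A homogeneous submodule. -/
noncomputable def sub {K : Submodule S M} (hK : hM.IsHomogeneous K) :
    HomProj 𝒮 (subGrading ℳ K) where
  proj := fun n =>
    { toFun := fun m => ⟨hM.proj n m, hK n m m.2⟩
      map_add' := fun a b => Subtype.ext (map_add (hM.proj n) a.1 b.1)
      map_smul' := fun r a => Subtype.ext (map_smul (hM.proj n) r a.1) }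
  proj_mem := fun n m => hM.proj_mem n m.1
  proj_of_mem := fun h => Subtype.ext (hM.proj_of_mem h)
  proj_of_ne := fun h hne => Subtype.ext (hM.proj_of_ne h hne)
  exists_sum := fun m => by
    obtain ⟨s, hs⟩ := hM.exists_sum m.1
    refine ⟨s, Subtype.ext ?_⟩
    rw [AddSubmonoidClass.coe_finsetSum]
    exact hs
  smul_mem := fun ha hm => hM.smul_mem ha hm

omit [IsScalarTower A S M] in
theorem isHomogeneous_bot : hM.IsHomogeneous ⊥ := fun n m hm => by
  rw [(Submodule.mem_bot S).1 hm, map_zero]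
  exact zero_mem _

omit [IsScalarTower A S M] in
theorem isHomogeneous_ker {b : Fin d → ℕ} {x : S} (hx : x ∈ 𝒮 b) :
    hM.IsHomogeneous (LinearMap.ker (LinearMap.lsmul S M x)) := fun n m hm => by
  rw [LinearMap.mem_ker, LinearMap.lsmul_apply] at hm ⊢
  rw [← hM.proj_smul hx, hm, map_zero]

omit [IsScalarTower A S M] in
theorem isHomogeneous_range {b : Fin d → ℕ} {x : S} (hx : x ∈ 𝒮 b) :
    hM.IsHomogeneous (LinearMap.range (LinearMap.lsmul S M x)) := by
  rintro n _ ⟨m, rfl⟩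
  rw [LinearMap.lsmul_apply]
  by_cases hb : b ≤ n
  · obtain ⟨c, rfl⟩ := exists_add_of_le hb
    rw [hM.proj_smul hx]
    exact ⟨_, rfl⟩
  · rw [hM.proj_smul_of_not_le hx hb]
    exact zero_mem _

omit [IsScalarTower A S M] in
theorem isHomogeneous_sup {N N' : Submodule S M} (hN : hM.IsHomogeneous N)
    (hN' : hM.IsHomogeneous N') : hM.IsHomogeneous (N ⊔ N') := fun n m hm => by
  obtain ⟨a, ha, b, hb, rfl⟩ := Submodule.mem_sup.1 hm
  rw [map_add]
  exact Submodule.add_mem_sup (hN n a ha) (hN' n b hb)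

/-- The Hilbert functions of `M`, `M / xM` and `(0 : x)`. -/
theorem length_add_length {b : Fin d → ℕ} {x : S} (hx : x ∈ 𝒮 b)
    {M' : Type*} [AddCommGroup M'] [Module A M'] [Module S M'] [IsScalarTower A S M']
    {ℳ' : (Fin d → ℕ) → Submodule A M'} (π : M →ₗ[S] M')
    (hπ : ∀ n, ℳ' n = (ℳ n).map (π.restrictScalars A))
    (hker : LinearMap.ker π = LinearMap.range (LinearMap.lsmul S M x)) (n : Fin d → ℕ) :
    Module.length A (ℳ n) + Module.length A (ℳ' (b + n)) =
      Module.length A (ℳ (b + n)) +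
        Module.length A (subGrading ℳ (LinearMap.ker (LinearMap.lsmul S M x)) n) := by
  set K := LinearMap.ker (LinearMap.lsmul S M x)
  let φ : ℳ n →ₗ[A] ℳ (b + n) :=
    ((LinearMap.lsmul S M x).restrictScalars A).restrict fun m hm => hM.smul_mem hx hm
  let ψ : ℳ (b + n) →ₗ[A] ℳ' (b + n) :=
    (π.restrictScalars A).restrict fun m hm => (hπ (b + n)).symm ▸ Submodule.mem_map_of_mem hm
  let ι : subGrading ℳ K n →ₗ[A] ℳ n :=
    (K.subtype.restrictScalars A).restrict fun m hm => hm
  -- The four-term sequence `0 → K_n → M_n → M_{b+n} → M'_{b+n} → 0` is split at the image of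
  -- multiplication by `x`.
  have h1 : Module.length A (ℳ n) =
      Module.length A (subGrading ℳ K n) + Module.length A (LinearMap.range φ) := by
    refine Module.length_eq_add_of_exact ι φ.rangeRestrict ?_ φ.surjective_rangeRestrict ?_
    · intro a b hab
      exact Subtype.ext (Subtype.ext (congrArg (fun z : ℳ n => (z : M)) hab))
    · intro m
      constructor
      · intro h
        have h0 : x • (m : M) = 0 := congrArg (fun z : LinearMap.range φ => ((z : ℳ (b + n)) : M)) h
        exact ⟨⟨⟨m, h0⟩, m.2⟩, rfl⟩
      · rintro ⟨a, rfl⟩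
        exact Subtype.ext (Subtype.ext a.1.2)
  have h2 : Module.length A (ℳ (b + n)) =
      Module.length A (LinearMap.range φ) + Module.length A (ℳ' (b + n)) := by
    refine Module.length_eq_add_of_exact (LinearMap.range φ).subtype ψ
      (Submodule.subtype_injective _) ?_ ?_
    · rintro ⟨m, hm⟩
      obtain ⟨y, hy, hym⟩ := (hπ (b + n)) ▸ hm
      exact ⟨⟨y, hy⟩, Subtype.ext hym⟩
    · intro m
      constructor
      · intro h
        have h0 : (m : M) ∈ LinearMap.ker π := congrArg Subtype.val h
        rw [hker] at h0
        obtain ⟨y, hy⟩ := h0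
        rw [LinearMap.lsmul_apply] at hy
        refine ⟨⟨m, ⟨hM.proj n y, hM.proj_mem n y⟩, Subtype.ext ?_⟩, rfl⟩
        change x • hM.proj n y = m
        rw [← hM.proj_smul hx, hy, hM.proj_of_mem m.2]
      · rintro ⟨⟨_, y, rfl⟩, rfl⟩
        have : x • (y : M) ∈ LinearMap.ker π := hker ▸ ⟨_, rfl⟩
        exact Subtype.ext this
  rw [h1, h2]
  ring

end HomProj

/-! ### Consequences of generation in total degree one. -/

section Standard

variable {𝒮 : (Fin d → ℕ) → Submodule A S} [GradedAlgebra 𝒮]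

/-- The projections of the graded algebra. -/
noncomputable def HomProj.self (𝒮 : (Fin d → ℕ) → Submodule A S) [GradedAlgebra 𝒮] :
    HomProj 𝒮 𝒮 :=
  haveI : SetLike.GradedSMul 𝒮 𝒮 := ⟨fun _ _ _ _ ha hb => SetLike.mul_mem_graded ha hb⟩
  HomProj.ofDecomposition 𝒮 𝒮

theorem mul_component_le (a b : Fin d → ℕ) : 𝒮 a * 𝒮 b ≤ 𝒮 (a + b) :=
  Submodule.mul_le.2 fun _ hm _ hn => SetLike.mul_mem_graded hm hn

/-- A monomial in the generators whose degree is positive in direction `i` has a factor in `𝒮 (e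
i)`, which commutativity moves to the front. -/
theorem exists_degree_of_mem_closure {w : S}
    (hw : w ∈ Submonoid.closure (⋃ i : Fin d, (𝒮 (e i) : Set S))) :
    ∃ n, w ∈ 𝒮 n ∧ (n = 0 → w = 1) ∧ ∀ i n', n = e i + n' → w ∈ 𝒮 (e i) * 𝒮 n' := by
  induction hw using Submonoid.closure_induction_left with
  | one =>
    refine ⟨0, SetLike.one_mem_graded 𝒮, fun _ => rfl, fun i n' h => ?_⟩
    have := congrFun h i
    simp at this
    omega
  | mul_left x hx y _ ih =>
    obtain ⟨j, hj⟩ := Set.mem_iUnion.1 hx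
    obtain ⟨n, hn, -, hfac⟩ := ih
    refine ⟨e j + n, SetLike.mul_mem_graded hj hn, fun h => ?_, fun i n' h => ?_⟩
    · have := congrFun h j
      simp at this
    rcases eq_or_ne i j with rfl | hij
    · rw [← add_left_cancel h]
      exact Submodule.mul_mem_mul hj hn
    · have hi : n i ≠ 0 := by
        have := congrFun h i
        simp [e_of_ne hij] at this
        omega
      obtain ⟨m, rfl⟩ := exists_eq_add_e hi
      obtain rfl : n' = e j + m := by
        refine add_left_cancel (a := e i) ?_
        rw [← h]
        ring
      have h1 : x * y ∈ 𝒮 (e j) * (𝒮 (e i) * 𝒮 m) :=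
        Submodule.mul_mem_mul hj (hfac i m (add_comm _ _))
      rw [mul_left_comm] at h1
      exact mul_le_mul_right (mul_component_le (e j) m) _ h1

namespace IsStandardGraded

variable (h𝒮 : IsStandardGraded 𝒮)
include h𝒮

/-- Monomials span `S` over `A`, and projecting to degree `n` leaves only those of degree `n`;
inclusions may be tested on them. -/
theorem component_le {n : Fin d → ℕ} {T : Submodule A S}
    (hT : ∀ w ∈ 𝒮 n, (n = 0 → w = 1) → (∀ i n', n = e i + n' → w ∈ 𝒮 (e i) * 𝒮 n') → w ∈ T) :
    𝒮 n ≤ T := by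
  intro s hs
  have hspan : s ∈ Submodule.span A
      (Submonoid.closure (⋃ i : Fin d, (𝒮 (e i) : Set S)) : Set S) := by
    rw [← Algebra.adjoin_eq_span, h𝒮.generated]
    trivial
  rw [← (HomProj.self 𝒮).proj_of_mem hs]
  clear hs
  induction hspan using Submodule.span_induction with
  | zero => simp
  | add a b _ _ ha hb => rw [map_add]; exact add_mem ha hb
  | smul r a _ ha => rw [map_smul]; exact T.smul_mem r ha
  | mem w hw =>
    obtain ⟨m, hm, h0, hfac⟩ := exists_degree_of_mem_closure hw
    rcases eq_or_ne m n with rfl | hne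
    · rw [(HomProj.self 𝒮).proj_of_mem hm]
      exact hT w hm h0 hfac
    · rw [(HomProj.self 𝒮).proj_of_ne hm hne]
      exact zero_mem _

theorem component_zero_le : 𝒮 0 ≤ 1 :=
  h𝒮.component_le fun w _ h0 _ => by
    rw [h0 rfl]
    exact Submodule.one_le.1 le_rfl

theorem component_add (a b : Fin d → ℕ) : 𝒮 (a + b) ≤ 𝒮 a * 𝒮 b := by
  induction a using induction_add_e generalizing b with
  | zero =>
    rw [zero_add]
    intro s hs
    rw [← one_mul s]
    exact Submodule.mul_mem_mul (SetLike.one_mem_graded 𝒮) hs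
  | add a i ih =>
    have h1 : 𝒮 (a + e i + b) ≤ 𝒮 (e i) * 𝒮 (a + b) :=
      h𝒮.component_le fun w _ _ hfac => hfac i (a + b) (by ring)
    refine h1.trans ((mul_le_mul_right (ih b) _).trans ?_)
    rw [← mul_assoc, add_comm a]
    exact mul_le_mul_left (mul_component_le _ _) _

theorem mem_plusPlus_pow (r : ℕ) (c : Fin d → ℕ) {s : S} (hs : s ∈ 𝒮 (r • 1 + c)) :
    s ∈ plusPlus 𝒮 ^ r := by
  induction r generalizing s with
  | zero => simp
  | succ r ih =>
    rw [succ_nsmul', add_assoc] at hs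
    have h1 := h𝒮.component_add _ _ hs
    clear hs
    rw [pow_succ']
    induction h1 using Submodule.mul_induction_on' with
    | mem_mul_mem a ha b hb =>
      exact Ideal.mul_mem_mul (Ideal.subset_span (Set.mem_biUnion (Set.mem_Ici.2 le_rfl) ha)) (ih hb)
    | add x _ y _ hx hy => exact add_mem hx hy

theorem exists_notMem_of_not_plusPlus_le {P : Ideal S} (hP : ¬ plusPlus 𝒮 ≤ P) (i : Fin d) :
    ∃ x ∈ 𝒮 (e i), x ∉ P := by
  by_contra! hi
  refine hP (Ideal.span_le.2 (Set.iUnion₂_subset fun n hn s hs => ?_))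
  have hne : n i ≠ 0 := by
    have := (Set.mem_Ici.1 hn) i
    simp at this
    omega
  obtain ⟨m, rfl⟩ := exists_eq_add_e hne
  rw [add_comm] at hs
  have h1 := h𝒮.component_add _ _ hs
  clear hs
  rw [SetLike.mem_coe]
  induction h1 using Submodule.mul_induction_on' with
  | mem_mul_mem a ha b hb => exact P.mul_mem_right _ (hi a ha)
  | add x _ y _ hx hy => exact add_mem hx hy

theorem exists_notMem_component {P : Ideal S} (hPp : P.IsPrime) (hP : ¬ plusPlus 𝒮 ≤ P)
    (n : Fin d → ℕ) : ∃ x ∈ 𝒮 n, x ∉ P := by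
  induction n using induction_add_e with
  | zero => exact ⟨1, SetLike.one_mem_graded 𝒮, P.ne_top_iff_one.1 hPp.ne_top⟩
  | add n i ih =>
    obtain ⟨x, hx, hxP⟩ := ih
    obtain ⟨y, hy, hyP⟩ := h𝒮.exists_notMem_of_not_plusPlus_le hP i
    exact ⟨x * y, SetLike.mul_mem_graded hx hy, fun h => (hPp.mem_or_mem h).elim hxP hyP⟩

variable {ℳ : (Fin d → ℕ) → Submodule A M}

/-- Since `S_0` is the image of `A`, the degree `n` part of `S W` is `W` again. So `W ↦ S W` embeds
the submodules of `M_n` strictly monotonically into those of `M`. -/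
theorem isNoetherian_component (hM : HomProj 𝒮 ℳ) [IsNoetherian S M] (n : Fin d → ℕ) :
    IsNoetherian A (ℳ n) := by
  let f : Submodule A (ℳ n) → Submodule S M := fun W => Submodule.span S (W.map (ℳ n).subtype)
  have hf : ∀ (W : Submodule A (ℳ n)) (m : ℳ n), (m : M) ∈ f W → m ∈ W := by
    intro W m hm
    -- Vanishing below degree `n` is carried along so that multiplication by positive degrees
    -- contributes nothing in degree `n`.
    suffices h : ∀ y ∈ f W, hM.proj n y ∈ W.map (ℳ n).subtype ∧ ∀ n' < n, hM.proj n' y = 0 by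
      have h1 := (h m hm).1
      rw [hM.proj_of_mem m.2] at h1
      obtain ⟨m', hm', h2⟩ := h1
      rwa [← Subtype.ext h2]
    intro y hy
    induction hy using Submodule.span_induction with
    | zero => simp
    | add a b _ _ ha hb =>
      refine ⟨?_, fun n' hn' => ?_⟩
      · rw [map_add]
        exact add_mem ha.1 hb.1
      · rw [map_add, ha.2 n' hn', hb.2 n' hn', add_zero]
    | mem y hy =>
      obtain ⟨w, hw, rfl⟩ := hy
      exact ⟨(hM.proj_of_mem w.2).symm ▸ ⟨w, hw, rfl⟩, fun n' hn' => hM.proj_of_ne w.2 hn'.ne'⟩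
    | smul a y _ hy =>
      induction a using (HomProj.self 𝒮).induction with
      | zero => simp
      | add a b ha hb =>
        refine ⟨?_, fun n' hn' => ?_⟩
        · rw [add_smul, map_add]
          exact add_mem ha.1 hb.1
        · rw [add_smul, map_add, ha.2 n' hn', hb.2 n' hn', add_zero]
      | hom i a ha =>
        have hlow : ∀ n' < n, hM.proj n' (a • y) = 0 := fun n' hn' => by
          by_cases hi : i ≤ n'
          · obtain ⟨c, rfl⟩ := exists_add_of_le hi
            rw [hM.proj_smul ha, hy.2 c (le_add_self.trans_lt hn'), smul_zero]
          · exact hM.proj_smul_of_not_le ha hi y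
        refine ⟨?_, hlow⟩
        by_cases hi : i ≤ n
        · by_cases hi0 : i = 0
          · subst hi0
            obtain ⟨r, rfl⟩ := Submodule.mem_one.1 (h𝒮.component_zero_le ha)
            rw [algebraMap_smul, map_smul]
            exact Submodule.smul_mem _ _ hy.1
          · obtain ⟨c, rfl⟩ := exists_add_of_le hi
            rw [hM.proj_smul ha, hy.2 c (lt_add_of_pos_left c (pos_iff_ne_zero.2 hi0)), smul_zero]
            exact zero_mem _
        · rw [hM.proj_smul_of_not_le ha hi]
          exact zero_mem _
  have hmono : StrictMono f := by
    refine Monotone.strictMono_of_injective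
      (fun W W' h => Submodule.span_mono (Submodule.map_mono h)) fun W W' h => ?_
    have key : ∀ W W' : Submodule A (ℳ n), f W = f W' → W ≤ W' := fun W W' h m hm =>
      hf W' m (h ▸ Submodule.subset_span ⟨m, hm, rfl⟩)
    exact le_antisymm (key _ _ h) (key _ _ h.symm)
  rw [isNoetherian_iff']
  exact hmono.wellFoundedGT

omit [IsScalarTower A S M] in
/-- If all minimal primes of the annihilator contain `S_{++}`, then `M_n = 0` for all large `n`. -/
theorem eventually_eq_zero (hM : HomProj 𝒮 ℳ) [IsNoetherianRing S] [Module.Finite S M]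
    (h : ∀ P ∈ (Module.annihilator S M).minimalPrimes, plusPlus 𝒮 ≤ P) :
    ∀ᶠ n in atTop, ∀ m ∈ ℳ n, m = 0 := by
  -- Some power `S_{++}^r` annihilates `M`, so a homogeneous generator of degree `j` contributes
  -- nothing in degrees `≥ r • 1 + j`.
  have hrad : plusPlus 𝒮 ≤ (Module.annihilator S M).radical := by
    rw [← Ideal.sInf_minimalPrimes]
    exact le_sInf h
  obtain ⟨r, hr⟩ := Ideal.exists_pow_le_of_le_radical_of_fg hrad (IsNoetherian.noetherian _)
  have hev : ∀ m : M, ∀ᶠ n in atTop, ∀ s : S, hM.proj n (s • m) = 0 := fun m => by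
    induction m using hM.induction with
    | zero => simp
    | add a b ha hb =>
      filter_upwards [ha, hb] with n hna hnb s
      rw [smul_add, map_add, hna, hnb, add_zero]
    | hom j m hm =>
      filter_upwards [eventually_ge_atTop (r • 1 + j)] with n hn s
      obtain ⟨c, rfl⟩ := exists_add_of_le hn
      induction s using (HomProj.self 𝒮).induction with
      | zero => simp
      | add a b ha hb => rw [add_smul, map_add, ha, hb, add_zero]
      | hom i s hs =>
        rcases eq_or_ne i (r • 1 + c) with rfl | hi
        · rw [Module.mem_annihilator.1 (hr (h𝒮.mem_plusPlus_pow r c hs)) m, map_zero]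
        · refine hM.proj_of_ne (hM.smul_mem hs hm) fun h => hi ?_
          rw [add_right_comm] at h
          exact add_right_cancel h
  obtain ⟨G, hG⟩ := Module.Finite.fg_top (R := S) (M := M)
  have hall : ∀ᶠ n in atTop, ∀ m ∈ G, ∀ s : S, hM.proj n (s • m) = 0 :=
    (Finset.eventually_all G).2 fun m _ => hev m
  filter_upwards [hall] with n hn m hm
  rw [← hM.proj_of_mem hm]
  have hmem : m ∈ Submodule.span S (G : Set M) := hG ▸ Submodule.mem_top
  suffices h : ∀ s : S, hM.proj n (s • m) = 0 by simpa using h 1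
  clear hm
  induction hmem using Submodule.span_induction with
  | zero => simp
  | add a b _ _ ha hb => intro s; rw [smul_add, map_add, ha, hb, add_zero]
  | smul t a _ ha => intro s; rw [smul_smul]; exact ha _
  | mem m hm => exact hn m hm

end IsStandardGraded

end Standard

/-! ### Prime avoidance and filter-regular elements. -/

/-- Over a local ring with infinite residue field, a module is not a finite union of proper
submodules. -/
theorem exists_forall_notMem {A V : Type*} [CommRing A] [IsLocalRing A]
    [Infinite (IsLocalRing.ResidueField A)] [AddCommGroup V] [Module A V]
    (F : Finset (Submodule A V)) (hF : ∀ W ∈ F, W ≠ ⊤) : ∃ x, ∀ W ∈ F, x ∉ W := by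
  induction F using Finset.induction_on with
  | empty => exact ⟨0, by simp⟩
  | insert W₀ F _ ih =>
    obtain ⟨x, hx⟩ := ih fun W hW => hF W (Finset.mem_insert_of_mem hW)
    by_cases hx₀ : x ∈ W₀
    swap
    · exact ⟨x, fun W hW => (Finset.mem_insert.1 hW).elim (fun h => h ▸ hx₀) (hx W)⟩
    obtain ⟨y, hy⟩ : ∃ y, y ∉ W₀ := by
      by_contra! h
      exact hF W₀ (Finset.mem_insert_self _ _) (Submodule.eq_top_iff'.2 h)
    have hlift : ∀ ρ : IsLocalRing.ResidueField A, ∃ a, IsLocalRing.residue A a = ρ :=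
      IsLocalRing.residue_surjective
    choose lift hlift using hlift
    -- Each `W` excludes at most one residue class: two would put a unit multiple of `x` in `W`.
    have hfin : (⋃ W ∈ F, {ρ | y + lift ρ • x ∈ W}).Finite := by
      refine F.finite_toSet.biUnion fun W hW => Set.Subsingleton.finite fun ρ hρ σ hσ => ?_
      by_contra hne
      have hu : IsUnit (lift ρ - lift σ) := by
        rw [← IsLocalRing.residue_ne_zero_iff_isUnit, map_sub, hlift, hlift, sub_ne_zero]
        exact hne
      have h1 : (lift ρ - lift σ) • x ∈ W := by
        have := W.sub_mem hρ hσ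
        rwa [add_sub_add_left_eq_sub, ← sub_smul] at this
      exact hx W hW ((W.smul_mem_iff_of_isUnit hu).1 h1)
    obtain ⟨ρ, hρ⟩ := hfin.exists_notMem
    simp only [Set.mem_iUnion, Set.mem_ofPred_eq, not_exists] at hρ
    refine ⟨y + lift ρ • x, fun W hW => (Finset.mem_insert.1 hW).elim (fun h => ?_) (hρ W)⟩
    rw [h, W₀.add_mem_iff_left (W₀.smul_mem _ hx₀)]
    exact hy

section FilterRegular

variable [IsLocalRing A] [Infinite (IsLocalRing.ResidueField A)] [IsNoetherianRing S]
  [Module.Finite S M] {𝒮 : (Fin d → ℕ) → Submodule A S} [GradedAlgebra 𝒮]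
  {ℳ : (Fin d → ℕ) → Submodule A M}

/-- A prime not containing `S_{++}` meets `𝒮 (e i)` in a proper `A`-submodule, and finitely many of
these do not cover `𝒮 (e i)`. -/
theorem IsStandardGraded.exists_forall_associatedPrimes_notMem (h𝒮 : IsStandardGraded 𝒮)
    (M : Type*) [AddCommGroup M] [Module S M] [Module.Finite S M] (i : Fin d) :
    ∃ x ∈ 𝒮 (e i), ∀ P ∈ associatedPrimes S M, ¬ plusPlus 𝒮 ≤ P → x ∉ P := by
  classical
  have hfin : {P ∈ associatedPrimes S M | ¬ plusPlus 𝒮 ≤ P}.Finite :=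
    (associatedPrimes.finite S M).subset (Set.sep_subset _ _)
  obtain ⟨x, hx⟩ := exists_forall_notMem (hfin.toFinset.image fun P : Ideal S =>
    (P.restrictScalars A).comap (𝒮 (e i)).subtype) fun W hW hT => by
      obtain ⟨P, hP, rfl⟩ := Finset.mem_image.1 hW
      obtain ⟨x, hx, hxP⟩ := h𝒮.exists_notMem_of_not_plusPlus_le
        ((hfin.mem_toFinset.1 hP).2) i
      exact hxP (show (⟨x, hx⟩ : 𝒮 (e i)) ∈
        (P.restrictScalars A).comap (𝒮 (e i)).subtype from hT ▸ Submodule.mem_top)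
  exact ⟨x, x.2, fun P hP hP' => hx _ (Finset.mem_image_of_mem _ (hfin.mem_toFinset.2 ⟨hP, hP'⟩))⟩

omit [IsLocalRing A] [Infinite (IsLocalRing.ResidueField A)] in
-- The minimal primes of the annihilator of `(0 : x)` are associated primes of `M` containing `x`.
-- By hypothesis they contain `S_{++}`, so `(0 : x)` vanishes in large degrees.
theorem IsStandardGraded.isFilterRegularElement (h𝒮 : IsStandardGraded 𝒮) (hM : HomProj 𝒮 ℳ)
    {b : Fin d → ℕ} {x : S} (hxb : x ∈ 𝒮 b)
    (hx : ∀ P ∈ associatedPrimes S M, ¬ plusPlus 𝒮 ≤ P → x ∉ P) : IsFilterRegularElement ℳ x := by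
  have := h𝒮.eventually_eq_zero (HomProj.sub (hM.isHomogeneous_ker hxb)) fun P hP => by
    by_contra hPp
    have hass := Module.associatedPrimes.minimalPrimes_annihilator_subset_associatedPrimes S
      (LinearMap.ker (LinearMap.lsmul S M x)) hP
    refine hx P (associatedPrimes.subset_of_injective (Submodule.subtype_injective _) hass) hPp ?_
    exact hP.1.2 (Module.mem_annihilator.2 fun m => Subtype.ext m.2)
  filter_upwards [this] with n hn m hm hxm
  exact congrArg Subtype.val (hn ⟨m, hxm⟩ hm)

end FilterRegular

end GradedModules

end MixedMult

namespace MixedMult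

open Filter MvPolynomial

/-! ### Existence, positivity and behaviour of Hilbert polynomials under quotients. -/

section HilbertPolynomials

universe u

variable {d : ℕ} {A S : Type*} [CommRing A] [CommRing S] [Algebra A S]
  {M : Type u} [AddCommGroup M] [Module A M] [Module S M] [IsScalarTower A S M]

/-- The Hilbert function of a graded module whose components have finite length. -/
noncomputable def hilbertFn (ℳ : (Fin d → ℕ) → Submodule A M) (n : Fin d → ℕ) : ℕ :=
  (Module.length A (ℳ n)).toNat

variable {𝒮 : (Fin d → ℕ) → Submodule A S} {ℳ : (Fin d → ℕ) → Submodule A M}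

theorem range_lsmul_eq (x : S) :
    LinearMap.range (LinearMap.lsmul S M x) = Ideal.span {x} • (⊤ : Submodule S M) := by
  ext m
  rw [Submodule.ideal_span_singleton_smul, Submodule.mem_smul_pointwise_iff_exists]
  simp

theorem listSmul_append_singleton (l : List S) (a : S) :
    listSmul M (l ++ [a]) = listSmul M l ⊔ LinearMap.range (LinearMap.lsmul S M a) := by
  rw [range_lsmul_eq, listSmul, listSmul, Ideal.ofList_append, Ideal.ofList_singleton,
    Submodule.sup_smul]

theorem listSmul_nil : listSmul M ([] : List S) = ⊥ := by
  rw [listSmul, Ideal.ofList_nil, Submodule.bot_smul]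

omit [IsScalarTower A S M] in
theorem HomProj.isHomogeneous_listSmul (hM : HomProj 𝒮 ℳ) {l : List S}
    (hl : ∀ a ∈ l, ∃ b, a ∈ 𝒮 b) : hM.IsHomogeneous (listSmul M l) := by
  induction l using List.reverseRecOn with
  | nil => rw [listSmul_nil]; exact hM.isHomogeneous_bot
  | append_singleton l a ih =>
    obtain ⟨b, hb⟩ := hl a (by simp)
    rw [listSmul_append_singleton]
    exact hM.isHomogeneous_sup (ih fun c hc => hl c (by simp [hc])) (hM.isHomogeneous_range hb)

theorem exists_degree_of_forall₂ {x : List S} {j : List (Fin d)}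
    (h : List.Forall₂ (fun a i => a ∈ 𝒮 (e i)) x j) : ∀ a ∈ x, ∃ b, a ∈ 𝒮 b := by
  induction h with
  | nil => simp
  | cons h _ ih => exact List.forall_mem_cons.2 ⟨⟨_, h⟩, ih⟩

/-- The projection `M / (x_1,…,x_t)M → M / (x_1,…,x_t,a)M`. -/
noncomputable def listSmulFactor (M : Type*) [AddCommGroup M] [Module S M] (l : List S) (a : S) :
    (M ⧸ listSmul M l) →ₗ[S] M ⧸ listSmul M (l ++ [a]) :=
  Submodule.factor ((listSmul_append_singleton (M := M) l a).symm ▸ le_sup_left)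

theorem quotGrading_listSmul_append (ℳ : (Fin d → ℕ) → Submodule A M) (l : List S) (a : S)
    (n : Fin d → ℕ) : quotGrading ℳ (listSmul M (l ++ [a])) n =
      (quotGrading ℳ (listSmul M l) n).map ((listSmulFactor M l a).restrictScalars A) := by
  rw [quotGrading, quotGrading, ← Submodule.map_comp]
  rfl

theorem ker_listSmulFactor (l : List S) (a : S) : LinearMap.ker (listSmulFactor M l a) =
    LinearMap.range (LinearMap.lsmul S (M ⧸ listSmul M l) a) := by
  ext m
  obtain ⟨m, rfl⟩ := (listSmul M l).mkQ_surjective m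
  rw [LinearMap.mem_ker]
  change (listSmul M (l ++ [a])).mkQ m = 0 ↔ _
  rw [← LinearMap.mem_ker, Submodule.ker_mkQ, listSmul_append_singleton]
  constructor
  · intro h
    obtain ⟨y, hy, _, ⟨z, rfl⟩, rfl⟩ := Submodule.mem_sup.1 h
    refine ⟨(listSmul M l).mkQ z, ?_⟩
    rw [map_add, show (listSmul M l).mkQ y = 0 by simpa using hy, zero_add]
    rfl
  · rintro ⟨z, hz⟩
    obtain ⟨z, rfl⟩ := (listSmul M l).mkQ_surjective z
    have h1 : m - a • z ∈ listSmul M l := by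
      rw [← (listSmul M l).ker_mkQ, LinearMap.mem_ker, map_sub, ← hz]
      simp
    rw [← sub_add_cancel m (a • z)]
    exact Submodule.add_mem_sup h1 ⟨z, rfl⟩

theorem multiDiff_e (i : Fin d) : multiDiff (e i) = diff i := by
  have := multiDiff_add_e (0 : Fin d → ℕ) i
  rwa [zero_add, multiDiff_zero, one_mul] at this

variable [GradedAlgebra 𝒮] [IsNoetherianRing S] [Module.Finite S M] [IsArtinianRing A] (h𝒮 : IsStandardGraded 𝒮) (hM : HomProj 𝒮 ℳ)
include h𝒮 hM

/-- The components are Noetherian over an Artinian ring, hence of finite length, so `toNat` loses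
nothing. -/
theorem coe_hilbertFn (n : Fin d → ℕ) : (hilbertFn ℳ n : ℕ∞) = Module.length A (ℳ n) := by
  have := h𝒮.isNoetherian_component hM n
  exact ENat.natCast_toNat Module.length_ne_top

theorem isHilbertPolynomial_iff {P : MvPolynomial (Fin d) ℚ} :
    IsHilbertPolynomial ℳ P ↔ ∀ᶠ n in atTop, (hilbertFn ℳ n : ℚ) = evalNat n P := by
  refine eventually_congr (.of_forall fun n => ?_)
  rw [← coe_hilbertFn h𝒮 hM n]
  constructor
  · rintro ⟨l, h1, h2⟩
    rw [ENat.natCast_inj.1 h1, ← h2]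
  · exact fun h => ⟨_, rfl, h.symm⟩

section Quotient

variable {b : Fin d → ℕ} {x : S} {M' : Type*} [AddCommGroup M'] [Module A M']
  [Module S M'] [IsScalarTower A S M'] [Module.Finite S M'] {ℳ' : (Fin d → ℕ) → Submodule A M'}

theorem hilbertFn_add (hx : x ∈ 𝒮 b) (hM' : HomProj 𝒮 ℳ') (π : M →ₗ[S] M')
    (hπ : ∀ n, ℳ' n = (ℳ n).map (π.restrictScalars A))
    (hker : LinearMap.ker π = LinearMap.range (LinearMap.lsmul S M x)) (n : Fin d → ℕ) :
    hilbertFn ℳ n + hilbertFn ℳ' (b + n) = hilbertFn ℳ (b + n) +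
      hilbertFn (subGrading ℳ (LinearMap.ker (LinearMap.lsmul S M x))) n := by
  have := hM.length_add_length hx π hπ hker n
  rw [← coe_hilbertFn h𝒮 hM, ← coe_hilbertFn h𝒮 hM, ← coe_hilbertFn h𝒮 hM',
    ← coe_hilbertFn h𝒮 (HomProj.sub (hM.isHomogeneous_ker hx))] at this
  exact_mod_cast this

theorem hilbertFn_add_of_filterRegular (hx : x ∈ 𝒮 b) (hreg : IsFilterRegularElement ℳ x)
    (hM' : HomProj 𝒮 ℳ') (π : M →ₗ[S] M') (hπ : ∀ n, ℳ' n = (ℳ n).map (π.restrictScalars A))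
    (hker : LinearMap.ker π = LinearMap.range (LinearMap.lsmul S M x)) :
    ∀ᶠ n in atTop, hilbertFn ℳ n + hilbertFn ℳ' (b + n) = hilbertFn ℳ (b + n) := by
  filter_upwards [hreg] with n hn
  rw [hilbertFn_add h𝒮 hM hx hM' π hπ hker, hilbertFn, hilbertFn, add_eq_left]
  have : Subsingleton (subGrading ℳ (LinearMap.ker (LinearMap.lsmul S M x)) n) :=
    subsingleton_of_forall_eq 0 fun m => Subtype.ext (Subtype.ext (hn m.1 m.2 m.1.2))
  rw [Module.length_eq_zero]
  rfl

theorem isHilbertPolynomial_diff {i : Fin d} (hx : x ∈ 𝒮 (e i))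
    (hreg : IsFilterRegularElement ℳ x) (hM' : HomProj 𝒮 ℳ') (π : M →ₗ[S] M')
    (hπ : ∀ n, ℳ' n = (ℳ n).map (π.restrictScalars A))
    (hker : LinearMap.ker π = LinearMap.range (LinearMap.lsmul S M x))
    {P : MvPolynomial (Fin d) ℚ} (hP : IsHilbertPolynomial ℳ P) :
    IsHilbertPolynomial ℳ' (diff i P) := by
  rw [isHilbertPolynomial_iff h𝒮 hM] at hP
  rw [isHilbertPolynomial_iff h𝒮 hM']
  refine eventually_of_add (b := e i) ?_
  filter_upwards [hP, eventually_add hP (e i),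
    hilbertFn_add_of_filterRegular h𝒮 hM hx hreg hM' π hπ hker] with n h1 h2 h3
  rw [evalNat_diff, ← h1, ← h2, add_comm n, ← h3]
  push_cast
  ring

end Quotient

variable [IsLocalRing A] [Infinite (IsLocalRing.ResidueField A)]

/-- The Hilbert polynomial exists. -/
theorem exists_isHilbertPolynomial : ∃ P, IsHilbertPolynomial ℳ P := by
  -- Noetherian induction over quotients of `M`, indexed by the kernel `N` of the map from `M`.
  suffices h : ∀ (N : Submodule S M) (M' : Type u) [AddCommGroup M'] [Module A M'] [Module S M']
      [IsScalarTower A S M'] (ℳ' : (Fin d → ℕ) → Submodule A M') (_ : HomProj 𝒮 ℳ')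
      (π : M →ₗ[S] M'), Function.Surjective π → LinearMap.ker π = N →
      ∃ P : MvPolynomial (Fin d) ℚ, ∀ᶠ n in atTop, (hilbertFn ℳ' n : ℚ) = evalNat n P by
    obtain ⟨P, hP⟩ := h ⊥ M ℳ hM LinearMap.id Function.surjective_id LinearMap.ker_id
    exact ⟨P, (isHilbertPolynomial_iff h𝒮 hM).2 hP⟩
  intro N
  induction N using WellFoundedGT.induction with
  | _ N ih =>
  intro M' _ _ _ _ ℳ' hM' π hπ hN
  have : Module.Finite S M' := Module.Finite.of_surjective π hπ
  choose x hxmem hx using h𝒮.exists_forall_associatedPrimes_notMem M'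
  have hreg : ∀ i, IsFilterRegularElement ℳ' (x i) := fun i =>
    h𝒮.isFilterRegularElement hM' (hxmem i) (hx i)
  -- If a filter-regular `x i` kills `M'`, then `M'` vanishes in large degrees. Otherwise every `M'
  -- / x_i M'` is a proper quotient, and its Hilbert function is the `i`-th difference.
  by_cases h0 : ∃ i, LinearMap.range (LinearMap.lsmul S M' (x i)) = ⊥
  · obtain ⟨i, hi⟩ := h0
    refine ⟨0, ?_⟩
    filter_upwards [hreg i] with n hn
    have : Subsingleton (ℳ' n) := subsingleton_of_forall_eq 0 fun m =>
      Subtype.ext (hn m m.2 (by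
        have : x i • (m : M') ∈ LinearMap.range (LinearMap.lsmul S M' (x i)) := ⟨_, rfl⟩
        rwa [hi] at this))
    rw [hilbertFn, Module.length_eq_zero]
    simp
  push Not at h0
  refine exists_polynomial_of_differences _ fun i => ?_
  have hQ := HomProj.quot (hM'.isHomogeneous_range (hxmem i))
  set R := LinearMap.range (LinearMap.lsmul S M' (x i)) with hR
  obtain ⟨P, hP⟩ := ih (LinearMap.ker (R.mkQ ∘ₗ π)) (by
    rw [LinearMap.ker_comp, Submodule.ker_mkQ, ← hN]
    refine lt_of_le_of_ne (fun m hm => ?_) fun h => h0 i ?_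
    · rw [Submodule.mem_comap, LinearMap.mem_ker.1 hm]
      exact zero_mem _
    · have := Submodule.map_comap_eq_of_surjective hπ R
      rw [← h] at this
      rw [← hR, ← this, eq_bot_iff]
      rintro _ ⟨m, hm, rfl⟩
      exact hm) (M' ⧸ R) _ hQ (R.mkQ ∘ₗ π)
    (R.mkQ_surjective.comp hπ) rfl
  refine ⟨P, ?_⟩
  filter_upwards [eventually_add hP (e i), hilbertFn_add_of_filterRegular h𝒮 hM' (hxmem i) (hreg i)
    hQ R.mkQ (fun _ => rfl) R.ker_mkQ] with n h1 h2
  rw [← h1, add_comm n, ← h2]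
  push_cast
  ring

-- Filter-regular quotients realise `Δ^h P` as a Hilbert polynomial, whose values are lengths. The
-- module is quantified inside so that the induction can replace it by a quotient.
omit hM in
omit [IsScalarTower A S M] [Module.Finite S M] [Module S M] [Module A M] [AddCommGroup M] in
theorem eventually_evalNat_multiDiff_nonneg (h : Fin d → ℕ) :
    ∀ (M : Type u) [AddCommGroup M] [Module A M] [Module S M] [IsScalarTower A S M]
      [Module.Finite S M] (ℳ : (Fin d → ℕ) → Submodule A M) (_ : HomProj 𝒮 ℳ)
      (P : MvPolynomial (Fin d) ℚ), IsHilbertPolynomial ℳ P →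
      ∀ᶠ n in atTop, 0 ≤ evalNat n (multiDiff h P) := by
  induction h using induction_add_e with
  | zero =>
    intro M _ _ _ _ _ ℳ hM P hP
    rw [isHilbertPolynomial_iff h𝒮 hM] at hP
    filter_upwards [hP] with n hn
    rw [multiDiff_zero, Module.End.one_apply, ← hn]
    positivity
  | add h i ih =>
    intro M _ _ _ _ _ ℳ hM P hP
    obtain ⟨x, hx, hxP⟩ := h𝒮.exists_forall_associatedPrimes_notMem M i
    have hQ := HomProj.quot (hM.isHomogeneous_range hx)
    have := ih _ _ hQ _ (isHilbertPolynomial_diff h𝒮 hM hx (h𝒮.isFilterRegularElement hM hx hxP) hQ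
      (Submodule.mkQ _) (fun _ => rfl) (Submodule.ker_mkQ _) hP)
    rwa [multiDiff_add_e]

/-- No regularity of `x` is assumed; positivity of differences for both `M` and `(0 : x)` prevents
their contributions from cancelling. -/
theorem multiDiff_add_e_eq_C_of_quotient {i : Fin d} {x : S} (hx : x ∈ 𝒮 (e i))
    {M' : Type*} [AddCommGroup M'] [Module A M'] [Module S M'] [IsScalarTower A S M']
    [Module.Finite S M'] {ℳ' : (Fin d → ℕ) → Submodule A M'} (hM' : HomProj 𝒮 ℳ')
    (π : M →ₗ[S] M') (hπ : ∀ n, ℳ' n = (ℳ n).map (π.restrictScalars A))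
    (hker : LinearMap.ker π = LinearMap.range (LinearMap.lsmul S M x))
    {P P' : MvPolynomial (Fin d) ℚ} (hP : IsHilbertPolynomial ℳ P)
    (hP' : IsHilbertPolynomial ℳ' P') {h : Fin d → ℕ} (hc : ∃ c, multiDiff h P' = C c) :
    ∃ c, multiDiff (h + e i) P = C c := by
  obtain ⟨c, hc⟩ := hc
  have hK := HomProj.sub (hM.isHomogeneous_ker hx)
  obtain ⟨κ, hκ⟩ := exists_isHilbertPolynomial h𝒮 hK
  -- `κ - diff i κ` is the shift `n ↦ κ(n - e_i)` written without a substitution.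
  have hPP' : P' = diff i P + (κ - diff i κ) := by
    have h1 := (isHilbertPolynomial_iff h𝒮 hM).1 hP
    have h2 := (isHilbertPolynomial_iff h𝒮 hM').1 hP'
    have h3 := (isHilbertPolynomial_iff h𝒮 hK).1 hκ
    refine eq_of_eventually_evalNat_eq (eventually_of_add (b := e i) ?_)
    filter_upwards [h1, eventually_add h1 (e i), eventually_add h2 (e i), h3] with n h1 h1' h2 h3
    have h4 := hilbertFn_add h𝒮 hM hx hM' π hπ hker n
    rw [map_add, map_sub, evalNat_diff, evalNat_diff, ← h1, ← h1', ← h2, ← h3, add_comm n]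
    have h5 : ((hilbertFn ℳ n + hilbertFn ℳ' (e i + n) : ℕ) : ℚ) = _ := congrArg Nat.cast h4
    push_cast at h5
    linear_combination h5
  refine eq_C_of_diff_eq_zero fun j => ?_
  have h0 : multiDiff (h + e j + e i) P + (multiDiff (h + e j) κ - diff i (multiDiff (h + e j) κ))
      = 0 := by
    have h1 : multiDiff (h + e j) P' = 0 := by
      rw [add_comm, multiDiff_add, Module.End.mul_apply, hc, multiDiff_e, diff_C]
    rw [hPP', map_add, map_sub, ← Module.End.mul_apply, ← multiDiff_add_e,
      ← Module.End.mul_apply (multiDiff (h + e j)) (diff i), ← multiDiff_add_e,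
      add_comm _ (e i), multiDiff_add (e i) (h + e j), multiDiff_e, Module.End.mul_apply] at h1
    rw [add_comm _ (e i), multiDiff_add (e i) (h + e j), multiDiff_e, Module.End.mul_apply]
    exact h1
  have h2 := eventually_evalNat_multiDiff_nonneg h𝒮 (h + e j + e i) M ℳ hM P hP
  have h3 := eventually_evalNat_multiDiff_nonneg h𝒮 (h + e j) _ _ hK κ hκ
  -- At `n + e i`, `h0` says that the difference of `P` there plus the difference of `κ` at `n` is
  -- zero; both are nonnegative for large `n`.
  have h4 : multiDiff (h + e j + e i) P = 0 := by
    refine eq_of_eventually_evalNat_eq (eventually_of_add (b := e i) ?_)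
    filter_upwards [eventually_add h2 (e i), h3] with n h2 h3
    have h5 := congrArg (evalNat (n + e i)) h0
    rw [map_add, map_sub, evalNat_diff, map_zero] at h5
    rw [map_zero]
    linarith
  rw [← h4, add_right_comm, add_comm _ (e j), multiDiff_add (e j), multiDiff_e,
    Module.End.mul_apply]

end HilbertPolynomials

end MixedMult

namespace MixedMult

open Filter MvPolynomial

/-! ### The dimension of `Supp_{++}`, and sequences of elements. -/

section Support

universe u

variable {d : ℕ} {A S : Type*} [CommRing A] [CommRing S] [Algebra A S]
  {M : Type u} [AddCommGroup M] [Module A M] [Module S M] [IsScalarTower A S M]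
  {ℳ : (Fin d → ℕ) → Submodule A M}

theorem count_append_singleton (j : List (Fin d)) (i : Fin d) :
    (fun l => (j ++ [i]).count l) = (fun l => j.count l) + e i := funext fun l => by
  rcases eq_or_ne l i with rfl | hl
  · simp
  · simp [e_of_ne hl, List.count_cons_of_ne hl.symm]

theorem isFilterRegularSequence_append_singleton {l : List S} {a : S}
    (hl : IsFilterRegularSequence ℳ l)
    (ha : IsFilterRegularElement (quotGrading ℳ (listSmul M l)) a) :
    IsFilterRegularSequence ℳ (l ++ [a]) := by
  intro i hi
  rcases lt_or_ge i l.length with h | h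
  · rw [List.take_append_of_le_length h.le, List.getElem_append_left h]
    exact hl i h
  · obtain rfl : i = l.length := by simp at hi; omega
    rw [List.take_append_of_le_length le_rfl, List.take_length, List.getElem_concat_length rfl]
    exact ha

theorem isHilbertPolynomial_quotGrading_listSmul_nil {P : MvPolynomial (Fin d) ℚ} (hP : IsHilbertPolynomial ℳ P) :
    IsHilbertPolynomial (quotGrading ℳ (listSmul M ([] : List S))) P := by
  refine hP.mono fun n hn => ?_
  have hinj : Function.Injective ((listSmul M ([] : List S)).mkQ.restrictScalars A) := by
    rw [← LinearMap.ker_eq_bot, LinearMap.ker_restrictScalars, Submodule.ker_mkQ, listSmul_nil,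
      Submodule.restrictScalars_bot]
  have := (Submodule.equivMapOfInjective _ hinj (ℳ n)).length_eq
  rw [quotGrading, ← this]
  exact hn

variable {𝒮 : (Fin d → ℕ) → Submodule A S} [GradedAlgebra 𝒮]

/-- Primality of the homogeneous core uses a linear order on the degrees. The componentwise order is
not linear, so the order is an explicit argument, later taken to be lexicographic. -/
theorem isPrime_homogeneousCore {ι σ R : Type*} [CommRing R] [AddCommMonoid ι]
    [dec : DecidableEq ι] [SetLike σ R] [AddSubmonoidClass σ R] (𝒜 : ι → σ) [GradedRing 𝒜]
    (L : LinearOrder ι) (hL : IsOrderedCancelAddMonoid ι) {I : Ideal R} (hI : I.IsPrime) :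
    (Ideal.homogeneousCore 𝒜 I).toIdeal.IsPrime := by
  have h : dec = L.toDecidableEq := Subsingleton.elim _ _
  subst h
  exact hI.homogeneousCore

omit [IsScalarTower A S M] in
theorem HomProj.isHomogeneous_annihilator (hM : HomProj 𝒮 ℳ) :
    (Module.annihilator S M).IsHomogeneous 𝒮 := by
  intro i s hs
  have key : ∀ (s : S) (j : Fin d → ℕ), ∀ m ∈ ℳ j,
      hM.proj (i + j) (s • m) = (HomProj.self 𝒮).proj i s • m := by
    intro s j m hm
    induction s using (HomProj.self 𝒮).induction with
    | zero => simp
    | add a b ha hb => rw [add_smul, map_add, ha, hb, map_add, add_smul]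
    | hom i' s hs =>
      rcases eq_or_ne i' i with rfl | hne
      · rw [(HomProj.self 𝒮).proj_of_mem hs, hM.proj_of_mem (hM.smul_mem hs hm)]
      · rw [(HomProj.self 𝒮).proj_of_ne hs hne, zero_smul,
          hM.proj_of_ne (hM.smul_mem hs hm) fun h => hne (add_right_cancel h)]
  refine Module.mem_annihilator.2 fun m => ?_
  change (HomProj.self 𝒮).proj i s • m = 0
  induction m using hM.induction with
  | zero => simp
  | add a b ha hb => rw [smul_add, ha, hb, add_zero]
  | hom j m hm => rw [← key s j m hm, Module.mem_annihilator.1 hs m, map_zero]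

/-- The lexicographic order on the degrees. -/
noncomputable abbrev lexLinearOrder (d : ℕ) : LinearOrder (Fin d → ℕ) :=
  inferInstanceAs (LinearOrder (Lex (Fin d → ℕ)))

/-- The homogeneous core of `P` is a prime between `I` and `P`, so it equals `P` by minimality. -/
theorem isHomogeneous_of_mem_minimalPrimes {I P : Ideal S} (hI : I.IsHomogeneous 𝒮)
    (hP : P ∈ I.minimalPrimes) : P.IsHomogeneous 𝒮 := by
  have hprime : (Ideal.homogeneousCore 𝒮 P).toIdeal.IsPrime :=
    isPrime_homogeneousCore 𝒮 (lexLinearOrder d)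
      (inferInstanceAs (IsOrderedCancelAddMonoid (Lex (Fin d → ℕ)))) hP.1.1
  have hle : I ≤ (Ideal.homogeneousCore 𝒮 P).toIdeal := by
    rw [← hI.toIdeal_homogeneousCore_eq_self]
    exact Ideal.homogeneousCore_mono 𝒮 hP.1.2
  rw [le_antisymm (hP.2 ⟨hprime, hle⟩ (Ideal.toIdeal_homogeneousCore_le 𝒮 P))
    (Ideal.toIdeal_homogeneousCore_le 𝒮 P)]
  exact HomogeneousIdeal.isHomogeneous _

theorem dimSuppPlusPlus_le_zero_iff {M : Type*} [AddCommGroup M] [Module S M] :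
    dimSuppPlusPlus 𝒮 M ≤ 0 ↔
      ∀ P ∈ suppPlusPlus 𝒮 M, ∀ Q ∈ suppPlusPlus 𝒮 M, P ≤ Q → Q ≤ P := by
  rw [dimSuppPlusPlus, Order.krullDim_nonpos_iff_forall_isMin]
  exact ⟨fun h P hP Q hQ hPQ => h ⟨Q, hQ⟩ (b := ⟨P, hP⟩) hPQ, fun h Q P hPQ => h P P.2 Q Q.2 hPQ⟩

variable [IsNoetherianRing S] [Module.Finite S M] [IsArtinianRing A]

/-- For `P ⊊ Q` in the support, the Hilbert function of `S/P` is monotone and bounded on large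
degrees, so it stabilises. Multiplication by a homogeneous `y ∈ Q \ P` is then onto in some degree,
which forces a whole component of `S` into `Q`. -/
theorem dimSuppPlusPlus_le_zero_of_isHilbertPolynomial_C (h𝒮 : IsStandardGraded 𝒮)
    (hM : HomProj 𝒮 ℳ) {c : ℚ} (hc : IsHilbertPolynomial ℳ (C c)) : dimSuppPlusPlus 𝒮 M ≤ 0 := by
  rw [dimSuppPlusPlus_le_zero_iff]
  rintro ⟨P, hPp⟩ ⟨⟨hPh, hPS⟩, hPM⟩ ⟨Q, hQp⟩ ⟨⟨hQh, hQS⟩, -⟩ hPQ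
  change Q ≤ P
  change P.IsHomogeneous 𝒮 at hPh
  change Q.IsHomogeneous 𝒮 at hQh
  change ¬ plusPlus 𝒮 ≤ P at hPS
  change ¬ plusPlus 𝒮 ≤ Q at hQS
  by_contra hQP
  obtain ⟨b, y, hyb, hyQ, hyP⟩ : ∃ b, ∃ y ∈ 𝒮 b, y ∈ Q ∧ y ∉ P := by
    by_contra! hall
    refine hQP fun q hq => ?_
    obtain ⟨s, hs⟩ := (HomProj.self 𝒮).exists_sum q
    rw [hs]
    exact sum_mem fun n _ => hall n _ ((HomProj.self 𝒮).proj_mem n q) (hQh n hq)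
  -- A homogeneous `m` with annihilator inside `P` exists: otherwise products of elements outside
  -- `P` would kill every sum of homogeneous elements.
  obtain ⟨δ, m, hm, hmP⟩ : ∃ δ, ∃ m ∈ ℳ δ, ∀ r : S, r • m = 0 → r ∈ P := by
    by_contra! hall
    have key : ∀ m : M, ∃ r : S, r • m = 0 ∧ r ∉ P := fun m => by
      induction m using hM.induction with
      | zero => exact ⟨1, by simp, P.ne_top_iff_one.1 hPp.ne_top⟩
      | add a b ha hb =>
        obtain ⟨r, hr, hrP⟩ := ha
        obtain ⟨t, ht, htP⟩ := hb
        refine ⟨r * t, ?_, fun h => (hPp.mem_or_mem h).elim hrP htP⟩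
        rw [smul_add, mul_smul, mul_smul, ht, smul_zero, add_zero, smul_comm, hr, smul_zero]
      | hom n m hm => exact hall n m hm
    obtain ⟨m, hm⟩ := Module.mem_support_iff'.1 hPM
    obtain ⟨r, hr, hrP⟩ := key m
    exact hm r hrP hr
  have hR : HomProj 𝒮 (quotGrading 𝒮 P) := HomProj.quot (hM := HomProj.self 𝒮) fun n s hs => hPh n hs
  set f := hilbertFn (A := A) (quotGrading 𝒮 P) with hf
  -- `S/P` is a quotient of `S/Ann(m) ≅ S m`, and `S_n m` lies in `ℳ (n + δ)`.
  have hbound : ∀ n, f n ≤ hilbertFn ℳ (n + δ) := fun n => by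
    let φ : 𝒮 n →ₗ[A] ℳ (n + δ) :=
      (((LinearMap.toSpanSingleton S M m).restrictScalars A).restrict
        fun s hs => hM.smul_mem hs hm)
    let ψ : 𝒮 n →ₗ[A] quotGrading 𝒮 P n :=
      ((P.mkQ.restrictScalars A).restrict fun s hs => ⟨s, hs, rfl⟩)
    have hle : LinearMap.ker φ ≤ LinearMap.ker ψ := fun s hs => by
      have h0 : (s : S) • m = 0 := congrArg (fun z : ℳ (n + δ) => (z : M)) hs
      exact Subtype.ext ((Submodule.Quotient.mk_eq_zero P).2 (hmP _ h0))
    have hsurj : Function.Surjective ((LinearMap.ker φ).liftQ ψ hle) := by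
      rintro ⟨_, s, hs, rfl⟩
      exact ⟨(LinearMap.ker φ).mkQ ⟨s, hs⟩, rfl⟩
    have h1 := Module.length_le_of_surjective _ hsurj
    have h2 := Module.length_le_of_injective (LinearMap.range φ).subtype
      (Submodule.subtype_injective _)
    rw [φ.quotKerEquivRange.length_eq] at h1
    have h3 := h1.trans h2
    rw [← coe_hilbertFn h𝒮 hR, ← coe_hilbertFn h𝒮 hM] at h3
    exact_mod_cast h3
  have hker : ∀ x ∉ P, ∀ z : S ⧸ P, x • z = 0 → z = 0 := by
    intro x hx z hz
    obtain ⟨z, rfl⟩ := P.mkQ_surjective z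
    rw [← map_smul, Submodule.mkQ_apply, Submodule.Quotient.mk_eq_zero] at hz
    rw [Submodule.mkQ_apply, Submodule.Quotient.mk_eq_zero]
    exact (hPp.mem_or_mem hz).resolve_left hx
  have hadd : ∀ (b : Fin d → ℕ), ∀ x ∈ 𝒮 b, x ∉ P → ∀ n, f n +
      hilbertFn (A := A) (quotGrading (quotGrading 𝒮 P)
        (LinearMap.range (LinearMap.lsmul S (S ⧸ P) x))) (b + n) = f (b + n) := by
    intro b x hx hxP n
    rw [hf, hilbertFn_add h𝒮 hR hx (HomProj.quot (hR.isHomogeneous_range hx)) (Submodule.mkQ _)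
      (fun _ => rfl) (Submodule.ker_mkQ _) n, add_eq_left, hilbertFn]
    have : Subsingleton (LinearMap.ker (LinearMap.lsmul S (S ⧸ P) x)) :=
      subsingleton_of_forall_eq 0 fun z => Subtype.ext (hker x hxP z.1 z.2)
    rw [Module.length_eq_zero]
    rfl
  have hmono : ∀ b n, f n ≤ f (b + n) := fun b n => by
    obtain ⟨x, hx, hxP⟩ := h𝒮.exists_notMem_component hPp hPS b
    rw [← hadd b x hx hxP n]
    exact Nat.le_add_right _ _
  obtain ⟨n₀, hn₀⟩ := eventually_atTop.1 (eventually_add ((isHilbertPolynomial_iff h𝒮 hM).1 hc) δ)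
  have hbdd : BddAbove (f '' Set.Ici n₀) := by
    refine ⟨hilbertFn ℳ (n₀ + δ), ?_⟩
    rintro _ ⟨n, hn, rfl⟩
    have h1 : (hilbertFn ℳ (n + δ) : ℚ) = hilbertFn ℳ (n₀ + δ) := by
      rw [hn₀ n hn, hn₀ n₀ le_rfl, eval_C, eval_C]
    exact (hbound n).trans (by exact_mod_cast h1.le)
  obtain ⟨n₁, hn₁, hmax⟩ := Nat.sSup_mem ⟨_, Set.mem_image_of_mem f (Set.mem_Ici.2 le_rfl)⟩ hbdd
  -- `f` is maximal at `n₁`, so multiplication by `y` loses no length and its cokernel vanishes in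
  -- degree `b + n₁`.
  have hle : f (b + n₁) ≤ f n₁ := by
    rw [hmax]
    exact le_csSup hbdd ⟨_, Set.mem_Ici.2 (le_trans hn₁ le_add_self), rfl⟩
  have hzero := hadd b y hyb hyP n₁
  have hquot := HomProj.quot (hR.isHomogeneous_range hyb)
  have hsub : Module.length A (quotGrading (quotGrading 𝒮 P)
      (LinearMap.range (LinearMap.lsmul S (S ⧸ P) y)) (b + n₁)) = 0 := by
    rw [← coe_hilbertFn h𝒮 hquot]
    have : hilbertFn (A := A) (quotGrading (quotGrading 𝒮 P)
        (LinearMap.range (LinearMap.lsmul S (S ⧸ P) y))) (b + n₁) = 0 := by omega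
    rw [this, Nat.cast_zero]
  rw [Module.length_eq_zero_iff] at hsub
  obtain ⟨t, ht, htQ⟩ := h𝒮.exists_notMem_component hQp hQS (b + n₁)
  have ht0 : (LinearMap.range (LinearMap.lsmul S (S ⧸ P) y)).mkQ (P.mkQ t) = 0 :=
    congrArg Subtype.val (Subsingleton.elim (⟨_, _, ⟨t, ht, rfl⟩, rfl⟩ : quotGrading
      (quotGrading 𝒮 P) (LinearMap.range (LinearMap.lsmul S (S ⧸ P) y)) (b + n₁)) 0)
  rw [← LinearMap.mem_ker, Submodule.ker_mkQ] at ht0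
  obtain ⟨z, hz⟩ := ht0
  obtain ⟨z, rfl⟩ := P.mkQ_surjective z
  have htz : t - y * z ∈ P := by
    rw [← P.ker_mkQ, LinearMap.mem_ker, map_sub, ← hz, ← smul_eq_mul, map_smul]
    simp
  change P ≤ Q at hPQ
  refine htQ ?_
  rw [← sub_add_cancel t (y * z)]
  exact Q.add_mem (hPQ htz) (Q.mul_mem_right _ hyQ)

variable [IsLocalRing A] [Infinite (IsLocalRing.ResidueField A)]

/-- If `Δ^{e_i} P ≠ 0`, the quotient by a generic `x` is nonzero in arbitrarily large degrees, so
its annihilator has a minimal prime `Q` not containing `S_{++}`. A minimal prime `P' ≤ Q` of `Ann M`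
avoids `x` while `x ∈ Q`, a chain of length one. -/
theorem eq_C_of_dimSuppPlusPlus_le_zero (h𝒮 : IsStandardGraded 𝒮) (hM : HomProj 𝒮 ℳ)
    {P : MvPolynomial (Fin d) ℚ} (hP : IsHilbertPolynomial ℳ P)
    (hdim : dimSuppPlusPlus 𝒮 M ≤ 0) : ∃ c, P = C c := by
  refine eq_C_of_diff_eq_zero fun i => ?_
  by_contra hne
  obtain ⟨x, hx, hxP⟩ := h𝒮.exists_forall_associatedPrimes_notMem M i
  set N := LinearMap.range (LinearMap.lsmul S M x) with hN
  have hQ : HomProj 𝒮 (quotGrading ℳ N) := HomProj.quot (hM.isHomogeneous_range hx)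
  have hHilb := isHilbertPolynomial_diff h𝒮 hM hx (h𝒮.isFilterRegularElement hM hx hxP) hQ
      (Submodule.mkQ _) (fun _ => rfl) (Submodule.ker_mkQ _) hP
  obtain ⟨Q, hQmin, hQS⟩ : ∃ Q ∈ (Module.annihilator S (M ⧸ N)).minimalPrimes,
      ¬ plusPlus 𝒮 ≤ Q := by
    by_contra! hall
    refine hne (eq_of_eventually_evalNat_eq ?_)
    filter_upwards [h𝒮.eventually_eq_zero hQ hall, (isHilbertPolynomial_iff h𝒮 hQ).1 hHilb]
      with n h1 h2
    have : Subsingleton (quotGrading ℳ N n) :=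
      subsingleton_of_forall_eq 0 fun m => Subtype.ext (h1 m m.2)
    rw [← h2, hilbertFn, Module.length_eq_zero, map_zero]
    rfl
  have hQp : Q.IsPrime := hQmin.1.1
  have hann : Module.annihilator S M ≤ Q :=
    (LinearMap.annihilator_le_of_surjective N.mkQ N.mkQ_surjective).trans hQmin.1.2
  obtain ⟨P', hP', hP'Q⟩ := Ideal.exists_minimalPrimes_le hann
  have hP'p : P'.IsPrime := hP'.1.1
  have hxQ : x ∈ Q := hQmin.1.2 (Module.mem_annihilator.2 fun m => by
    obtain ⟨m, rfl⟩ := N.mkQ_surjective m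
    rw [← map_smul, Submodule.mkQ_apply, Submodule.Quotient.mk_eq_zero]
    exact ⟨m, rfl⟩)
  have hP'S : ¬ plusPlus 𝒮 ≤ P' := fun h => hQS (h.trans hP'Q)
  have hxP' := hxP P'
    (Module.associatedPrimes.minimalPrimes_annihilator_subset_associatedPrimes S M hP') hP'S
  refine hxP' (dimSuppPlusPlus_le_zero_iff.1 hdim ⟨P', hP'p⟩ ⟨⟨?_, hP'S⟩, ?_⟩ ⟨Q, hQp⟩
    ⟨⟨?_, hQS⟩, ?_⟩ hP'Q hxQ)
  · exact isHomogeneous_of_mem_minimalPrimes hM.isHomogeneous_annihilator hP'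
  · exact Module.mem_support_iff_of_finite.2 hP'.1.2
  · exact isHomogeneous_of_mem_minimalPrimes hQ.isHomogeneous_annihilator hQmin
  · exact Module.mem_support_iff_of_finite.2 hann

theorem exists_isFilterRegularSequence (h𝒮 : IsStandardGraded 𝒮) (hM : HomProj 𝒮 ℳ)
    {P : MvPolynomial (Fin d) ℚ} (hP : IsHilbertPolynomial ℳ P) (j : List (Fin d)) :
    ∃ x : List S, List.Forall₂ (fun a i => a ∈ 𝒮 (e i)) x j ∧ IsFilterRegularSequence ℳ x ∧
      IsHilbertPolynomial (quotGrading ℳ (listSmul M x)) (multiDiff (fun l => j.count l) P) := by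
  induction j using List.reverseRecOn with
  | nil =>
    refine ⟨[], .nil, fun i hi => absurd hi (by simp), ?_⟩
    have : (fun l : Fin d => ([] : List (Fin d)).count l) = 0 := funext fun l => by simp
    rw [this, multiDiff_zero]
    exact isHilbertPolynomial_quotGrading_listSmul_nil hP
  | append_singleton j i ih =>
    obtain ⟨x, hxj, hreg, hx⟩ := ih
    obtain ⟨a, ha, haP⟩ := h𝒮.exists_forall_associatedPrimes_notMem (M ⧸ listSmul M x) i
    have hxa : List.Forall₂ (fun a i => a ∈ 𝒮 (e i)) (x ++ [a]) (j ++ [i]) :=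
      List.rel_append hxj (.cons ha .nil)
    have hN := HomProj.quot (hM.isHomogeneous_listSmul (exists_degree_of_forall₂ hxj))
    have hN' := HomProj.quot (hM.isHomogeneous_listSmul (exists_degree_of_forall₂ hxa))
    have hareg := h𝒮.isFilterRegularElement hN ha haP
    refine ⟨x ++ [a], hxa, isFilterRegularSequence_append_singleton hreg hareg, ?_⟩
    rw [count_append_singleton, add_comm, multiDiff_add, multiDiff_e]
    exact isHilbertPolynomial_diff h𝒮 hN ha hareg hN' (listSmulFactor M x a)
      (quotGrading_listSmul_append ℳ x a) (ker_listSmulFactor x a) hx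

/-- Entries are removed from the end of `x`; `h` is general because each removal adds one `e i` to
it. -/
theorem multiDiff_eq_C_of_listSmul (h𝒮 : IsStandardGraded 𝒮) (hM : HomProj 𝒮 ℳ)
    {P : MvPolynomial (Fin d) ℚ} (hP : IsHilbertPolynomial ℳ P) {x : List S} {j : List (Fin d)}
    (hxj : List.Forall₂ (fun a i => a ∈ 𝒮 (e i)) x j) {P' : MvPolynomial (Fin d) ℚ}
    (hP' : IsHilbertPolynomial (quotGrading ℳ (listSmul M x)) P') {h : Fin d → ℕ}
    (hc : ∃ c, multiDiff h P' = C c) : ∃ c, multiDiff (h + fun l => j.count l) P = C c := by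
  induction j using List.reverseRecOn generalizing x P' h with
  | nil =>
    obtain rfl := List.forall₂_nil_right_iff.1 hxj
    have hN := HomProj.quot (hM.isHomogeneous_listSmul (exists_degree_of_forall₂ hxj))
    have h1 := (isHilbertPolynomial_iff h𝒮 hN).1 hP'
    have h2 := (isHilbertPolynomial_iff h𝒮 hN).1
      (isHilbertPolynomial_quotGrading_listSmul_nil hP)
    have hPP' : P = P' := eq_of_eventually_evalNat_eq (by
      filter_upwards [h1, h2] with n h1 h2
      rw [← h1, ← h2])
    have : (fun l : Fin d => ([] : List (Fin d)).count l) = 0 := funext fun l => by simp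
    rwa [this, add_zero, hPP']
  | append_singleton j i ih =>
    have htake := List.forall₂_take_append _ _ _ hxj
    have hdrop := List.forall₂_drop_append _ _ _ hxj
    obtain ⟨a, ha, hdrop'⟩ : ∃ a ∈ 𝒮 (e i), x.drop j.length = [a] := by
      obtain ⟨a, u, ha, hu, hau⟩ := List.forall₂_cons_right_iff.1 hdrop
      rw [List.forall₂_nil_right_iff.1 hu] at hau
      exact ⟨a, ha, hau⟩
    have hx : x = x.take j.length ++ [a] := by rw [← hdrop', List.take_append_drop]
    set y := x.take j.length
    clear_value y
    subst hx
    have hyj : List.Forall₂ (fun a i => a ∈ 𝒮 (e i)) y j := htake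
    have hN := HomProj.quot (hM.isHomogeneous_listSmul (exists_degree_of_forall₂ hyj))
    have hN' := HomProj.quot (hM.isHomogeneous_listSmul (exists_degree_of_forall₂ hxj))
    obtain ⟨R, hR⟩ := exists_isHilbertPolynomial h𝒮 hN
    have := multiDiff_add_e_eq_C_of_quotient h𝒮 hN ha hN' (listSmulFactor M y a)
      (quotGrading_listSmul_append ℳ y a) (ker_listSmulFactor y a) hR hP' hc
    rw [count_append_singleton, add_comm _ (e i), ← add_assoc]
    exact ih hyj hR this

end Support

theorem exists_list_count_eq {d : ℕ} (k : Fin d → ℕ) : ∃ j : List (Fin d), ∀ i, j.count i = k i := by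
  induction k using induction_add_e with
  | zero => exact ⟨[], fun i => by simp⟩
  | add k i ih =>
    obtain ⟨j, hj⟩ := ih
    exact ⟨j ++ [i], fun l => by rw [congrFun (count_append_singleton j i) l, Pi.add_apply, hj]; rfl⟩

end MixedMult

/-! ### The equivalences. -/

theorem mainTheorem5 {d : ℕ} (hd : 0 < d) {A S M : Type*}
    [CommRing A] [IsLocalRing A] [IsArtinianRing A] [Infinite (IsLocalRing.ResidueField A)]
    [CommRing S] [Algebra A S]
    (𝒮 : (Fin d → ℕ) → Submodule A S) [GradedAlgebra 𝒮] (h𝒮 : MixedMult.IsStandardGraded 𝒮)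
    [AddCommGroup M] [Module A M] [Module S M] [IsScalarTower A S M] [Module.Finite S M]
    (ℳ : (Fin d → ℕ) → Submodule A M) [DirectSum.Decomposition ℳ] [SetLike.GradedSMul 𝒮 ℳ]
    (k : Fin d → ℕ) :
    (∃! P, MixedMult.IsHilbertPolynomial ℳ P) ∧
    (∃! c, MixedMult.IsBinomExpansion (MixedMult.hilbertPolynomial ℳ) c) ∧
    List.TFAE [
      ∃ x : List S, MixedMult.IsFilterRegularSequence ℳ x ∧
        MixedMult.IsMixedMultiplicitySystem 𝒮 M k x,
      ∃ x : List S, MixedMult.IsMixedMultiplicitySystem 𝒮 M k x,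
      ∃ c : ℚ, MixedMult.multiDiff k (MixedMult.hilbertPolynomial ℳ) = MvPolynomial.C c,
      MixedMult.MixedMultiplicityDefined ℳ k] := by
  open MixedMult in
  have : IsNoetherianRing S :=
    haveI := h𝒮.finiteType
    Algebra.FiniteType.isNoetherianRing A S
  have hM := HomProj.ofDecomposition 𝒮 ℳ
  have hex := exists_isHilbertPolynomial h𝒮 hM
  have hP : IsHilbertPolynomial ℳ (hilbertPolynomial ℳ) := by
    rw [hilbertPolynomial, dif_pos hex]
    exact hex.choose_spec
  have hP' := (isHilbertPolynomial_iff h𝒮 hM).1 hP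
  have hexc : ∃ c, IsBinomExpansion (hilbertPolynomial ℳ) c :=
    exists_isBinomExpansion (hP'.mono fun n hn => ⟨hilbertFn ℳ n, by rw [← hn]; simp⟩)
  have hc : IsBinomExpansion (hilbertPolynomial ℳ) (hilbertCoeff ℳ) := by
    rw [hilbertCoeff, binomCoeffs, dif_pos hexc]
    exact hexc.choose_spec
  refine ⟨⟨_, hP, fun Q hQ => eq_of_eventually_evalNat_eq ?_⟩,
    ⟨_, hc, fun c hc' => isBinomExpansion_unique hc' hc⟩, ?_⟩
  · filter_upwards [hP', (isHilbertPolynomial_iff h𝒮 hM).1 hQ] with n h1 h2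
    rw [← h1, ← h2]
  tfae_have 1 → 2 := fun ⟨x, _, hx⟩ => ⟨x, hx⟩
  tfae_have 2 → 3 := by
    rintro ⟨x, ⟨j, hxj, hj⟩, hdim⟩
    have hN := HomProj.quot (hM.isHomogeneous_listSmul (exists_degree_of_forall₂ hxj))
    obtain ⟨R, hR⟩ := exists_isHilbertPolynomial h𝒮 hN
    have h1 := multiDiff_eq_C_of_listSmul h𝒮 hM hP hxj hR (h := 0) (by
      rw [multiDiff_zero]
      exact eq_C_of_dimSuppPlusPlus_le_zero h𝒮 hN hR hdim)
    rwa [zero_add, funext hj] at h1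
  -- A generic sequence of type `k` has a quotient with Hilbert polynomial `Δ^k P_M`; its constancy
  -- bounds the dimension of the support.
  tfae_have 3 → 1 := by
    rintro ⟨c, hc⟩
    obtain ⟨j, hj⟩ := exists_list_count_eq k
    obtain ⟨x, hxj, hreg, hx⟩ := exists_isFilterRegularSequence h𝒮 hM hP j
    rw [funext hj, hc] at hx
    exact ⟨x, hreg, ⟨j, hxj, hj⟩, dimSuppPlusPlus_le_zero_of_isHilbertPolynomial_C h𝒮
      (HomProj.quot (hM.isHomogeneous_listSmul (exists_degree_of_forall₂ hxj))) hx⟩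
  tfae_have 3 ↔ 4 := multiDiff_eq_C_iff hc k
  tfae_finish
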